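/- Let $X$ be a complex Banach space, $(T(t))_{t\ge 0}$ a $C_0$-semigroup on $X$ with generator $A:D(A)\to X$, $\sigma(A)$ the spectrum of $A$ and $R(\lambda,A)=(\lambda-A)^{-1}$ its resolvent. Assume that there are $a\in(0,\infty)$ and $\theta\in(\tfrac12,\infty)$ such that $$\{t\in\mathbb R: it\in\sigma(A)\}\subset(-a,a)\qquad\text{and}\qquad \sup_{t\in\mathbb R,\ |t|\ge a}|t|^{\theta}\,\|R(it,A)\|<\infty .$$ Let $\phi\in L^\infty(\mathbb R,X)$, and let $$sp(\phi)=\Big\{\omega\in\mathbb R:\ \int_{\mathbb R} f(t)e^{-i\omega t}\,dt=0\ \text{ for every } f\in L^1(\mathbb R,\mathbb C)\text{ with }\phi*f=0\Big\}$$ be its Beurling spectrum. Assume that $(i\,sp(\phi))\cap\sigma(A)=\emptyset$ and that $\sup_{t>0}\|T(t)\|<\infty$. Then for every $x\in X$ the Cauchy problem $u'=Au+\phi$ on $\mathbb R_+=[0,\infty)$, $u(0)=x$, has a unique mild solution, and this solution is bounded and uniformly continuous on $\mathbb R_+$. Here a mild solution is a continuous function $u:\mathbb R_+\to X$ with $u(0)=x$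 such that, for all $t\ge 0$, $\int_0^t u(s)\,ds\in D(A)$ and $$u(t)=x+A\int_0^t u(s)\,ds+\int_0^t\phi(s)\,ds .$$ -/

import Mathlib

open Set Filter Topology MeasureTheory

noncomputable section

namespace EvolEq

variable {X : Type*} [NormedAddCommGroup X] [NormedSpace ℂ X]

/-- `(T t)_{t ≥ 0}` is a `C₀`-semigroup of bounded operators on `X`. Only the values `T t` with
`0 ≤ t` matter here and in every definition below. -/
structure IsC0Semigroup (T : ℝ → X →L[ℂ] X) : Prop where
  map_zero : T 0 = 1
  map_add : ∀ s t : ℝ, 0 ≤ s → 0 ≤ t → T (s + t) = T s * T t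
  continuousOn : ∀ x : X, ContinuousOn (fun t => T t x) (Ici 0)

/-- The graph of the infinitesimal generator of `T`: all pairs `(x, y)` such that
`(T h x - x) / h → y` as `h → 0+`. -/
def generatorGraph (T : ℝ → X →L[ℂ] X) : Submodule ℂ (X × X) where
  carrier := {p | Tendsto (fun h : ℝ => h⁻¹ • (T h p.1 - p.1)) (𝓝[>] 0) (𝓝 p.2)}
  zero_mem' := by simp
  add_mem' := by
    intro p q hp hq
    refine (Tendsto.add hp hq).congr fun h => ?_
    simp only [Prod.fst_add, map_add, ← smul_add]
    congr 1
    abel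
  smul_mem' := by
    intro c p hp
    refine (Tendsto.const_smul hp c).congr fun h => ?_
    simp only [Prod.smul_fst, map_smul, ← smul_sub]
    rw [smul_comm]

/-- The infinitesimal generator `A : D(A) → X` of `T`, with
`D(A) = {x | lim_{h → 0+} (T h x - x) / h exists}` and `A x` this limit. -/
def generator (T : ℝ → X →L[ℂ] X) : X →ₗ.[ℂ] X :=
  (generatorGraph T).toLinearPMap

/-- `A x = y` (with `x ∈ D(A)`) if and only if `(T h x - x) / h → y` as `h → 0+`. -/
theorem mem_graph_generator (T : ℝ → X →L[ℂ] X) (x y : X) :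
    (x, y) ∈ (generator T).graph ↔
      Tendsto (fun h : ℝ => h⁻¹ • (T h x - x)) (𝓝[>] 0) (𝓝 y) := by
  have hg : ∀ p ∈ generatorGraph T, p.1 = 0 → p.2 = 0 := by
    rintro ⟨a, b⟩ hp rfl
    have h0 : Tendsto (fun h : ℝ => h⁻¹ • (T h (0 : X) - 0)) (𝓝[>] 0) (𝓝 b) := hp
    simp only [map_zero, sub_zero, smul_zero] at h0
    exact tendsto_nhds_unique h0 tendsto_const_nhds
  rw [generator, Submodule.toLinearPMap_graph_eq _ hg]
  rfl

/-- The bounded operator `R` on `X` is a two-sided inverse of `z - A : D(A) → X`. -/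
def IsResolventAt (A : X →ₗ.[ℂ] X) (z : ℂ) (R : X →L[ℂ] X) : Prop :=
  (∀ y : X, ∃ h : R y ∈ A.domain, z • R y - A ⟨R y, h⟩ = y) ∧
    ∀ x : A.domain, R (z • (x : X) - A x) = x

/-- The spectrum `σ(A)`: all `z` for which `z - A : D(A) → X` has no bounded inverse. -/
def spectrum (A : X →ₗ.[ℂ] X) : Set ℂ :=
  {z | ¬ ∃ R : X →L[ℂ] X, IsResolventAt A z R}

open Classical in
/-- The resolvent `R(z, A) = (z - A)⁻¹` for `z ∉ σ(A)` (and `0` for `z ∈ σ(A)`). -/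
def resolvent (A : X →ₗ.[ℂ] X) (z : ℂ) : X →L[ℂ] X :=
  if h : ∃ R : X →L[ℂ] X, IsResolventAt A z R then h.choose else 0

/-- The value at `w` of the Fourier transform `∫ f(t) e^{-iwt} dt` of `f ∈ L¹(ℝ, ℂ)`. -/
def fourierL1 (f : ℝ → ℂ) (w : ℝ) : ℂ :=
  ∫ t : ℝ, f t * Complex.exp (-(Complex.I * w * t))

/-- The Beurling spectrum of `φ ∈ L^∞(ℝ, X)`: the common zeros of the Fourier transforms of all
`f ∈ L¹(ℝ, ℂ)` with `φ * f = 0`. -/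
def beurlingSpectrum (φ : ℝ → X) : Set ℝ :=
  {w | ∀ f : ℝ → ℂ, Integrable f → (∀ t : ℝ, ∫ s : ℝ, f s • φ (t - s) = 0) → fourierL1 f w = 0}

/-- `u` is a mild solution of `u' = A u + φ` on `J` (where `J` is `[0, ∞)` or `ℝ`): `u` is
continuous on `J` and, for all `t ∈ J`, `∫₀ᵗ u ∈ D(A)` and
`u t = u 0 + A (∫₀ᵗ u) + ∫₀ᵗ φ`. -/
def IsMildSolution (A : X →ₗ.[ℂ] X) (φ : ℝ → X) (J : Set ℝ) (u : ℝ → X) : Prop :=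
  ContinuousOn u J ∧ ∀ t ∈ J, ∃ h : (∫ s in (0 : ℝ)..t, u s) ∈ A.domain,
    u t = u 0 + A ⟨∫ s in (0 : ℝ)..t, u s, h⟩ + ∫ s in (0 : ℝ)..t, φ s

/-- `u` is bounded and uniformly continuous on `J`. -/
def IsBUCOn (u : ℝ → X) (J : Set ℝ) : Prop :=
  (∃ C : ℝ, ∀ t ∈ J, ‖u t‖ ≤ C) ∧ UniformContinuousOn u J

end EvolEq

end

/-! Write R(z) for the resolvent of A. The solution is built on the whole line as v = G * φ, where G
is an operator kernel whose Fourier transform is (1 - ψ(ξ)) R(2πiξ). The cutoff ψ is 1 near the part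
of the spectrum on the imaginary axis, and 𝓕⁻ψ * φ = 0. Cutting off R(2πiξ) where it is undefined
then loses nothing, because φ has no frequencies there.

Such a ψ exists because the imaginary spectrum is compact and, after rescaling, disjoint from the
Beurling spectrum. `exists_pos_forall_convolution_eq_zero` treats one frequency by a direct
estimate, and `exists_cutoff_convolution_eq_zero` patches by compactness.

The kernel is split as G = N + W with N(t) = e^{-t} T(t) for t > 0, whose transform is R(1 + 2πiξ).
Boundedness of T carries the decay of R to the line Re z = 1. Since θ > 1/2, the square of R is
integrable there, so t N(t), its inverse Fourier transform, is continuous in operator norm. Hence N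
is Bochner integrable (`integrable_expKernel`). The transform of W is `symbol`, which is C² and
decays with two derivatives like |ξ|^{-2θ}, so W is integrable too (`integrable_symbol`).

The resolvent identity gives W = N * W - N * 𝓕⁻ψ + N * N (`fourierInv_symbol_eq`). Convolving with φ
kills the middle term and leaves v = N * (φ + v), the integral form of v' = (A - 1)v + (φ + v). As
an L¹ * L^∞ convolution, v is bounded and uniformly continuous, and it is a mild solution
(`isMildSolution_of_integral_eq`). Adding the orbit T(t)(x - v(0)), which is also bounded and
uniformly continuous, corrects the initial value. Uniqueness comes from
`eq_zero_of_isMildSolution_homogeneous`. -/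

section

open scoped FourierTransform Convolution Real ContDiff

noncomputable section

namespace EvolEq

/-! ### Bounded measurable functions on the line. -/

section BddMeas

variable {F : Type*} [NormedAddCommGroup F]

/-- A bounded measurable function on the line, in the form in which it enters convolutions. -/
structure BddMeas (g : ℝ → F) (C : ℝ) : Prop where
  meas : AEStronglyMeasurable g volume
  bdd : ∀ᵐ t, ‖g t‖ ≤ C

theorem BddMeas.comp_sub_left {g : ℝ → F} {C : ℝ} (hg : BddMeas g C) (t : ℝ) :
    BddMeas (fun s => g (t - s)) C :=
  ⟨hg.meas.comp_quasiMeasurePreserving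
    (quasiMeasurePreserving_sub_left_of_right_invariant volume t),
    (quasiMeasurePreserving_sub_left_of_right_invariant volume t).ae hg.bdd⟩

theorem BddMeas.of_continuous {g : ℝ → F} {C : ℝ} (hc : Continuous g) (hb : ∀ t, ‖g t‖ ≤ C) :
    BddMeas g C :=
  ⟨hc.aestronglyMeasurable, Eventually.of_forall hb⟩

theorem BddMeas.add {g k : ℝ → F} {C D : ℝ} (hg : BddMeas g C) (hk : BddMeas k D) :
    BddMeas (fun t => g t + k t) (C + D) :=
  ⟨hg.meas.add hk.meas, by
    filter_upwards [hg.bdd, hk.bdd] with t h1 h2 using (norm_add_le _ _).trans (add_le_add h1 h2)⟩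

theorem BddMeas.norm {g : ℝ → F} {C : ℝ} (hg : BddMeas g C) : BddMeas (fun s => ‖g s‖) C :=
  ⟨hg.meas.norm, by simpa using hg.bdd⟩

end BddMeas

/-! ### Convolutions of L¹ with L^∞. -/

section Convolution

variable {E F G H K L : Type*}
  [NormedAddCommGroup E] [NormedSpace ℂ E] [NormedAddCommGroup F] [NormedSpace ℂ F]
  [NormedAddCommGroup G] [NormedSpace ℂ G] [NormedAddCommGroup H] [NormedSpace ℂ H]
  [NormedAddCommGroup K] [NormedSpace ℂ K] [NormedAddCommGroup L] [NormedSpace ℂ L]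

theorem BddMeas.convolutionExistsAt {f : ℝ → E} {g : ℝ → F} {C : ℝ} (hf : Integrable f)
    (hg : BddMeas g C) (B : E →L[ℂ] F →L[ℂ] G) (t : ℝ) :
    ConvolutionExistsAt f g t B volume := by
  have h := hg.comp_sub_left t
  refine (hf.norm.const_mul (‖B‖ * C)).mono' (B.aestronglyMeasurable_comp₂ hf.1 h.meas) ?_
  filter_upwards [h.bdd] with s hs
  calc ‖B (f s) (g (t - s))‖ ≤ ‖B‖ * ‖f s‖ * ‖g (t - s)‖ := B.le_opNorm₂ _ _
    _ ≤ ‖B‖ * ‖f s‖ * C := by gcongr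
    _ = ‖B‖ * C * ‖f s‖ := by ring

theorem BddMeas.norm_convolution_le {f : ℝ → E} {g : ℝ → F} {C : ℝ} (hf : Integrable f)
    (hg : BddMeas g C) (B : E →L[ℂ] F →L[ℂ] G) (t : ℝ) :
    ‖(f ⋆[B] g) t‖ ≤ ‖B‖ * C * ∫ s, ‖f s‖ := by
  rw [← integral_const_mul]
  refine norm_integral_le_of_norm_le (hf.norm.const_mul (‖B‖ * C)) ?_
  filter_upwards [(hg.comp_sub_left t).bdd] with s hs
  calc ‖B (f s) (g (t - s))‖ ≤ ‖B‖ * ‖f s‖ * ‖g (t - s)‖ := B.le_opNorm₂ _ _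
    _ ≤ ‖B‖ * ‖f s‖ * C := by gcongr
    _ = ‖B‖ * C * ‖f s‖ := by ring

/-- Associativity of the convolution `L¹ * L¹ * L^∞`. -/
theorem BddMeas.convolution_assoc {f : ℝ → E} {g : ℝ → F} {k : ℝ → G} {C : ℝ}
    (hf : Integrable f) (hg : Integrable g) (hk : BddMeas k C)
    (B₁ : E →L[ℂ] F →L[ℂ] H) (B₂ : H →L[ℂ] G →L[ℂ] L) (B₃ : E →L[ℂ] K →L[ℂ] L)
    (B₄ : F →L[ℂ] G →L[ℂ] K) [CompleteSpace H] [CompleteSpace K] [CompleteSpace L]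
    (hB : ∀ x y z, B₂ (B₁ x y) z = B₃ x (B₄ y z)) (t : ℝ) :
    ((f ⋆[B₁] g) ⋆[B₂] k) t = (f ⋆[B₃] (g ⋆[B₄] k)) t := by
  have hk' := hk.norm
  have hex : ∀ x, ConvolutionExistsAt (fun x => ‖g x‖) (fun x => ‖k x‖) x
      (ContinuousLinearMap.mul ℝ ℝ) volume := by
    intro x
    have h := hk'.comp_sub_left x
    refine (hg.norm.const_mul C).mono' (hg.1.norm.mul h.meas) ?_
    filter_upwards [h.bdd] with s hs
    simp only [ContinuousLinearMap.mul_apply', norm_mul, norm_norm] at hs ⊢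
    rw [mul_comm]
    exact mul_le_mul_of_nonneg_right hs (norm_nonneg _)
  have hC : ∀ x, ‖((fun x => ‖g x‖) ⋆[ContinuousLinearMap.mul ℝ ℝ] (fun x => ‖k x‖)) x‖ ≤
      C * ∫ s, ‖g s‖ := by
    intro x
    rw [← integral_const_mul]
    refine norm_integral_le_of_norm_le (hg.norm.const_mul C) ?_
    filter_upwards [(hk'.comp_sub_left x).bdd] with s hs
    simp only [ContinuousLinearMap.mul_apply', norm_mul, norm_norm] at hs ⊢
    rw [mul_comm]
    exact mul_le_mul_of_nonneg_right hs (norm_nonneg _)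
  refine MeasureTheory.convolution_assoc B₁ B₂ B₃ B₄ hB hf.1 hg.1 hk.meas
    (hf.ae_convolution_exists B₁ hg) (Eventually.of_forall hex) ?_
  have hm : AEStronglyMeasurable
      ((fun x => ‖g x‖) ⋆[ContinuousLinearMap.mul ℝ ℝ] (fun x => ‖k x‖)) volume := by
    have h2 : AEStronglyMeasurable (fun p : ℝ × ℝ => ‖g p.2‖ * ‖k (p.1 - p.2)‖)
        (volume.prod volume) :=
      hg.1.norm.comp_snd.mul (hk.meas.norm.comp_quasiMeasurePreserving
        (quasiMeasurePreserving_sub_of_right_invariant volume volume))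
    exact h2.integral_prod_right'
  refine (hf.norm.const_mul (C * ∫ s, ‖g s‖)).mono' (hf.1.norm.mul
    (hm.comp_quasiMeasurePreserving
      (quasiMeasurePreserving_sub_left_of_right_invariant volume t))) ?_
  refine Eventually.of_forall fun s => ?_
  simp only [ContinuousLinearMap.mul_apply', norm_mul, norm_norm]
  rw [mul_comm]
  gcongr
  exact hC _

end Convolution

/-! ### Continuity of translation in L¹. -/

section Translation

variable {E : Type*} [NormedAddCommGroup E]

/-- The modulus of continuity in the mean of an integrable function is continuous. -/
theorem continuous_integral_norm_translate_sub {f : ℝ → E} (hf : Integrable f) :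
    Continuous (fun h : ℝ => ∫ t, ‖f (h + t) - f t‖) := by
  have : Fact ((1 : ENNReal) ≠ ⊤) := ⟨by simp⟩
  have hf1 : MemLp f 1 volume := memLp_one_iff_integrable.2 hf
  have hc : Continuous (fun h : ℝ => ‖((DomAddAct.mk h) +ᵥ hf1.toLp f) - hf1.toLp f‖) := by
    have : Continuous (fun h : ℝ => (DomAddAct.mk h) +ᵥ hf1.toLp f) :=
      (DomAddAct.continuous_mk).vadd continuous_const
    fun_prop
  refine hc.congr fun h => ?_
  rw [L1.norm_eq_integral_norm]
  rw [DomAddAct.mk_vadd_toLp]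
  refine integral_congr_ae ?_
  filter_upwards [Lp.coeFn_sub (MemLp.toLp _ (hf1.comp_measurePreserving
    (measurePreserving_vadd h volume))) (hf1.toLp f), hf1.coeFn_toLp,
    (hf1.comp_measurePreserving (measurePreserving_vadd h volume)).coeFn_toLp] with t h1 h2 h3
  exact congrArg norm (h1.trans (congrArg₂ (· - ·) h3 h2))

end Translation

/-! ### Vector-valued Fourier transforms: injectivity, decay, inversion. -/

section Fourier

variable {E : Type*} [NormedAddCommGroup E] [NormedSpace ℂ E]

/-- The difference has transform zero, which is trivially integrable, so inversion applies to it
without any integrability of the two transforms themselves. -/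
theorem eq_of_fourier_eq [CompleteSpace E] {f g : ℝ → E} (hf : Continuous f) (hfi : Integrable f)
    (hg : Continuous g) (hgi : Integrable g) (h : 𝓕 f = 𝓕 g) : f = g := by
  have h0 : 𝓕 (f - g) = 0 := by
    ext w
    have := congrFun h w
    simp only [Real.fourier_eq, Pi.zero_apply, Pi.sub_apply, smul_sub] at this ⊢
    rw [integral_sub, this, sub_self]
    · exact (Real.fourierIntegral_convergent_iff w).2 hfi
    · exact (Real.fourierIntegral_convergent_iff w).2 hgi
  have := Continuous.fourierInv_fourier_eq (hf.sub hg) (hfi.sub hgi)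
    (by rw [h0]; exact integrable_zero _ _ _)
  rw [h0] at this
  have h2 : f - g = 0 := by
    rw [← this]; ext w; simp [Real.fourierInv_eq]
  exact sub_eq_zero.1 h2

/-- Decay of the Fourier transform of a function with two integrable derivatives. -/
theorem exists_norm_fourier_le {f : ℝ → E} (hf : ContDiff ℝ 2 f) (h0 : Integrable f)
    (h1 : Integrable (deriv f)) (h2 : Integrable (deriv (deriv f))) :
    ∃ C, ∀ t, ‖𝓕 f t‖ ≤ C * (1 + t ^ 2)⁻¹ := by
  have hd : ContDiff ℝ 1 (deriv f) := (contDiff_succ_iff_deriv.1 (by rw [one_add_one_eq_two]; exact hf)).2.2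
  have e1 := Real.fourier_deriv h0 (hf.differentiable (by norm_num)) h1
  have e2 := Real.fourier_deriv h1 (hd.differentiable (by norm_num)) h2
  refine ⟨(∫ t, ‖f t‖) + ∫ t, ‖deriv (deriv f) t‖, fun t => ?_⟩
  have b : ∀ g : ℝ → E, ‖𝓕 g t‖ ≤ ∫ t, ‖g t‖ := fun g =>
    VectorFourier.norm_fourierIntegral_le_integral_norm _ _ _ _ _
  have b2 := b (deriv (deriv f))
  rw [congrFun e2 t, congrFun e1 t, norm_smul, norm_smul] at b2
  have hn : ‖(2 * π * Complex.I * t : ℂ)‖ = 2 * π * |t| := by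
    simp [abs_of_pos Real.pi_pos]
  rw [hn] at b2
  rw [← div_eq_mul_inv, le_div_iff₀ (by positivity)]
  have : t ^ 2 * ‖𝓕 f t‖ ≤ 2 * π * |t| * (2 * π * |t| * ‖𝓕 f t‖) := by
    have hp : 1 ≤ 2 * π := by linarith [Real.pi_gt_three]
    have : 1 ≤ (2 * π) * (2 * π) := by nlinarith
    calc t ^ 2 * ‖𝓕 f t‖ = 1 * (|t| ^ 2 * ‖𝓕 f t‖) := by rw [sq_abs, one_mul]
      _ ≤ ((2 * π) * (2 * π)) * (|t| ^ 2 * ‖𝓕 f t‖) := by gcongr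
      _ = _ := by ring
  linarith [b f]

theorem exists_norm_fourierInv_le {f : ℝ → E} (hf : ContDiff ℝ 2 f) (h0 : Integrable f)
    (h1 : Integrable (deriv f)) (h2 : Integrable (deriv (deriv f))) :
    ∃ C, ∀ t, ‖𝓕⁻ f t‖ ≤ C * (1 + t ^ 2)⁻¹ := by
  obtain ⟨C, hC⟩ := exists_norm_fourier_le hf h0 h1 h2
  refine ⟨C, fun t => ?_⟩
  rw [Real.fourierInv_eq_fourier_neg]
  simpa using hC (-t)

theorem continuous_fourierInv {f : ℝ → E} (h0 : Integrable f) : Continuous (𝓕⁻ f) := by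
  have : 𝓕⁻ f = fun t => 𝓕 f (-t) := by ext t; exact Real.fourierInv_eq_fourier_neg f t
  rw [this]
  have : Continuous (𝓕 f) := VectorFourier.fourierIntegral_continuous Real.continuous_fourierChar
    (by fun_prop) h0
  exact this.comp continuous_neg

theorem integrable_fourierInv {f : ℝ → E} (hf : ContDiff ℝ 2 f) (h0 : Integrable f)
    (h1 : Integrable (deriv f)) (h2 : Integrable (deriv (deriv f))) : Integrable (𝓕⁻ f) := by
  obtain ⟨C, hC⟩ := exists_norm_fourierInv_le hf h0 h1 h2
  exact (integrable_inv_one_add_sq.const_mul C).mono' (continuous_fourierInv h0).aestronglyMeasurable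
    (Eventually.of_forall hC)

theorem integrable_fourier {f : ℝ → E} (h : Integrable (𝓕⁻ f)) : Integrable (𝓕 f) := by
  have : 𝓕 f = fun t => 𝓕⁻ f (-t) := by
    ext t; rw [Real.fourierInv_eq_fourier_neg, neg_neg]
  rw [this]
  exact h.comp_neg

theorem fourier_fourierInv_of_integrable [CompleteSpace E] {f : ℝ → E} (hc : Continuous f)
    (h0 : Integrable f) (h1 : Integrable (𝓕⁻ f)) : 𝓕 (𝓕⁻ f) = f :=
  hc.fourier_fourierInv_eq h0 (integrable_fourier h1)

theorem integrable_fourierInv_of_hasCompactSupport {f : ℝ → E} (hf : ContDiff ℝ 2 f)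
    (hs : HasCompactSupport f) : Integrable (𝓕⁻ f) := by
  have hd : ContDiff ℝ 1 (deriv f) := (contDiff_succ_iff_deriv.1 (by rw [one_add_one_eq_two]; exact hf)).2.2
  exact integrable_fourierInv hf (hf.continuous.integrable_of_hasCompactSupport hs)
    (hd.continuous.integrable_of_hasCompactSupport hs.deriv)
    ((hd.continuous_deriv (by norm_num)).integrable_of_hasCompactSupport hs.deriv.deriv)

end Fourier

/-! ### Beurling spectrum: convolution with band-limited functions off the spectrum vanishes. -/

section Beurling

variable {X : Type*} [NormedAddCommGroup X] [NormedSpace ℂ X]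

theorem norm_fourierInv_le {E : Type*} [NormedAddCommGroup E] [NormedSpace ℂ E] (f : ℝ → E)
    (t : ℝ) : ‖𝓕⁻ f t‖ ≤ ∫ s, ‖f s‖ := by
  rw [Real.fourierInv_eq_fourier_neg]
  exact VectorFourier.norm_fourierIntegral_le_integral_norm _ _ _ _ _

theorem fourierL1_eq (f : ℝ → ℂ) (w : ℝ) : fourierL1 f (2 * π * w) = 𝓕 f w := by
  rw [fourierL1, Real.fourier_real_eq_integral_exp_smul]
  refine integral_congr_ae (Eventually.of_forall fun t => ?_)
  simp only [smul_eq_mul]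
  rw [mul_comm]
  congr 2
  push_cast
  ring

/-- Turns a fixed frequency window 𝓕χ into one of width ε around ξ₀ whose kernel keeps its L¹ norm.
-/
theorem fourier_modulate_dilate (χ : ℝ → ℂ) {ε : ℝ} (hε : 0 < ε) (ξ₀ ξ : ℝ) :
    𝓕 (fun t : ℝ => (ε : ℂ) * (Complex.exp (2 * π * Complex.I * ξ₀ * t) * χ (ε * t))) ξ =
      𝓕 χ ((ξ - ξ₀) / ε) := by
  rw [Real.fourier_real_eq_integral_exp_smul, Real.fourier_real_eq_integral_exp_smul]
  have := Measure.integral_comp_mul_left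
    (fun u : ℝ => Complex.exp (↑(-2 * π * u * ((ξ - ξ₀) / ε)) * Complex.I) • χ u) ε
  rw [abs_of_pos (inv_pos.2 hε)] at this
  have h2 := congrArg (fun z => (ε : ℝ) • z) this
  simp only [smul_smul, mul_inv_cancel₀ hε.ne', one_smul] at h2
  rw [← h2, ← integral_smul]
  refine integral_congr_ae (Eventually.of_forall fun t => ?_)
  simp only [smul_eq_mul, Complex.real_smul]
  have : Complex.exp (↑(-2 * π * (ε * t) * ((ξ - ξ₀) / ε)) * Complex.I) =
      Complex.exp (↑(-2 * π * t * ξ) * Complex.I) *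
        Complex.exp (2 * π * Complex.I * ξ₀ * t) := by
    rw [← Complex.exp_add]
    congr 1
    have : (ε : ℂ) ≠ 0 := by exact_mod_cast hε.ne'
    push_cast
    field_simp
    ring
  rw [this]
  ring

theorem exists_contDiff_cutoff : ∃ V : ℝ → ℂ, ContDiff ℝ 2 V ∧ HasCompactSupport V ∧
    ∀ x, |x| ≤ 1 → V x = 1 := by
  let b : ContDiffBump (0 : ℝ) := ⟨1, 2, by norm_num, by norm_num⟩
  refine ⟨fun x => (b x : ℂ), Complex.ofRealCLM.contDiff.comp b.contDiff,
    b.hasCompactSupport.comp_left (g := fun x : ℝ => (x : ℂ)) (by simp), fun x hx => ?_⟩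
  have : b x = 1 := b.one_of_mem_closedBall (by simpa [b] using hx)
  simp [this]

/-- The modulus of continuity in the mean. -/
def meanModulus {E : Type*} [NormedAddCommGroup E] (f : ℝ → E) (h : ℝ) : ℝ :=
  ∫ t, ‖f (h + t) - f t‖

theorem continuous_meanModulus {E : Type*} [NormedAddCommGroup E] {f : ℝ → E}
    (hf : Integrable f) : Continuous (meanModulus f) :=
  continuous_integral_norm_translate_sub hf

theorem meanModulus_zero {E : Type*} [NormedAddCommGroup E] (f : ℝ → E) :
    meanModulus f 0 = 0 := by
  simp [meanModulus]

theorem meanModulus_nonneg {E : Type*} [NormedAddCommGroup E] (f : ℝ → E) (h : ℝ) :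
    0 ≤ meanModulus f h :=
  integral_nonneg fun _ => norm_nonneg _

theorem meanModulus_le {E : Type*} [NormedAddCommGroup E] {f : ℝ → E}
    (hf : Integrable f) (h : ℝ) : meanModulus f h ≤ 2 * ∫ t, ‖f t‖ := by
  have h1 : Integrable (fun t => ‖f (h + t)‖) := (hf.comp_add_left h).norm
  calc meanModulus f h ≤ ∫ t, (‖f (h + t)‖ + ‖f t‖) :=
        integral_mono ((hf.comp_add_left h).sub hf).norm (h1.add hf.norm)
          fun t => norm_sub_le _ _
    _ = 2 * ∫ t, ‖f t‖ := by
        rw [integral_add h1 hf.norm, integral_add_left_eq_self (fun t => ‖f t‖) h]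
        ring

theorem integrable_modulate_dilate {χ : ℝ → ℂ} (hχ : Integrable χ) {ε : ℝ} (hε : 0 < ε)
    (ξ₀ : ℝ) : Integrable
      (fun t : ℝ => (ε : ℂ) * (Complex.exp (2 * π * Complex.I * ξ₀ * t) * χ (ε * t))) := by
  refine Integrable.const_mul ?_ _
  have h1 : Integrable (fun t => χ (ε * t)) := hχ.comp_mul_left' hε.ne'
  refine h1.bdd_mul (c := 1) (by fun_prop) (Eventually.of_forall fun t => le_of_eq ?_)
  rw [Complex.norm_exp]
  simp

/-- A function whose spectrum lies near `ξ₀` is almost an eigenfunction of translations. -/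
theorem norm_modulate_translate_sub_le {F : ℝ → X} {χ : ℝ → ℂ} {S ε ξ₀ : ℝ}
    (hε : 0 < ε) (hF : BddMeas F S) (hχ : Integrable χ)
    (hrep : ∀ t, F t = ((fun t : ℝ => (ε : ℂ) * (Complex.exp (2 * π * Complex.I * ξ₀ * t) *
      χ (ε * t))) ⋆[ContinuousLinearMap.lsmul ℂ ℂ] F) t) (s t : ℝ) :
    ‖Complex.exp (2 * π * Complex.I * ξ₀ * s) • F (t - s) - F t‖ ≤
      S * meanModulus χ (-(ε * s)) := by
  set Y : ℝ → ℂ := fun t => (ε : ℂ) * (Complex.exp (2 * π * Complex.I * ξ₀ * t) * χ (ε * t))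
    with hY
  have hYi : Integrable Y := integrable_modulate_dilate hχ hε ξ₀
  have e1 : F (t - s) = ∫ r, Y (r - s) • F (t - r) := by
    rw [hrep (t - s)]
    refine (integral_sub_right_eq_self (fun r => Y r • F (t - s - r)) s).symm.trans ?_
    refine integral_congr_ae (Eventually.of_forall fun r => ?_)
    have : t - s - (r - s) = t - r := by ring
    simp only [this]
  have hi1 : Integrable (fun r => Y r • F (t - r)) :=
    hF.convolutionExistsAt hYi (ContinuousLinearMap.lsmul ℂ ℂ) t
  have hi2 : Integrable (fun r => Y (r - s) • F (t - r)) :=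
    hF.convolutionExistsAt (hYi.comp_sub_right s) (ContinuousLinearMap.lsmul ℂ ℂ) t
  have e2 : F t = ∫ r, Y r • F (t - r) := hrep t
  have hi3 : Integrable (fun r => Complex.exp (2 * π * Complex.I * ξ₀ * s) •
      Y (r - s) • F (t - r)) := hi2.smul _
  rw [e1, e2, ← integral_smul, ← integral_sub hi3 hi1]
  have e3 : ∀ r, ‖Complex.exp (2 * π * Complex.I * ξ₀ * s) * Y (r - s) - Y r‖ =
      ε * ‖χ (-(ε * s) + ε * r) - χ (ε * r)‖ := by
    intro r
    have : Complex.exp (2 * π * Complex.I * ξ₀ * s) * Y (r - s) - Y r =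
        (ε : ℂ) * (Complex.exp (2 * π * Complex.I * ξ₀ * r) *
          (χ (-(ε * s) + ε * r) - χ (ε * r))) := by
      have h1 : Complex.exp (2 * π * Complex.I * ξ₀ * r) =
          Complex.exp (2 * π * Complex.I * ξ₀ * s) *
            Complex.exp (2 * π * Complex.I * ξ₀ * (r - s : ℝ)) := by
        rw [← Complex.exp_add]; congr 1; push_cast; ring
      have h2 : ε * (r - s) = -(ε * s) + ε * r := by ring
      simp only [hY, h2]
      rw [h1]; ring
    rw [this, norm_mul, norm_mul, Complex.norm_exp, Complex.norm_real, Real.norm_eq_abs,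
      abs_of_pos hε]
    simp
  have e4 : ∫ r, ε * ‖χ (-(ε * s) + ε * r) - χ (ε * r)‖ = meanModulus χ (-(ε * s)) := by
    rw [integral_const_mul, Measure.integral_comp_mul_left
      (fun u => ‖χ (-(ε * s) + u) - χ u‖) ε, abs_of_pos (inv_pos.2 hε), smul_eq_mul,
      ← mul_assoc, mul_inv_cancel₀ hε.ne', one_mul, meanModulus]
  rw [← e4, ← integral_const_mul]
  refine norm_integral_le_of_norm_le ?_ ?_
  · refine Integrable.const_mul ?_ _
    refine Integrable.const_mul ?_ _
    exact (((hχ.comp_add_left (-(ε * s))).sub hχ).comp_mul_left' hε.ne').norm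
  · filter_upwards [(hF.comp_sub_left t).bdd] with r hr
    rw [smul_smul, ← sub_smul, norm_smul, e3, mul_comm S]
    gcongr

/-- A function with frequencies within ε of ξ₀ behaves like a multiple of the character of frequency
ξ₀, on which convolution with g acts as multiplication by 𝓕g(ξ₀) ≠ 0. If g * F = 0, the error of
this approximation must account for all of F; when the error is at most half the supremum of ‖F‖,
that supremum is 0. This replaces local inversion in the Wiener algebra. -/
theorem eq_zero_of_convolution_eq_zero [CompleteSpace X] {F : ℝ → X} {g : ℝ → ℂ} {χ : ℝ → ℂ}
    {D ε ξ₀ : ℝ} (hε : 0 < ε) (hF : AEStronglyMeasurable F volume) (hFb : ∀ t, ‖F t‖ ≤ D)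
    (hg : Integrable g) (hχ : Integrable χ)
    (hrep : ∀ t, F t = ((fun t : ℝ => (ε : ℂ) * (Complex.exp (2 * π * Complex.I * ξ₀ * t) *
      χ (ε * t))) ⋆[ContinuousLinearMap.lsmul ℂ ℂ] F) t)
    (hgF : ∀ t, (g ⋆[ContinuousLinearMap.lsmul ℂ ℂ] F) t = 0)
    (hsmall : ∫ s, ‖g s‖ * meanModulus χ (-(ε * s)) ≤ ‖𝓕 g ξ₀‖ / 2)
    (hne : 𝓕 g ξ₀ ≠ 0) (t : ℝ) : F t = 0 := by
  set S := ⨆ t, ‖F t‖ with hS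
  have hbdd : BddAbove (range fun t => ‖F t‖) := ⟨D, by rintro _ ⟨t, rfl⟩; exact hFb t⟩
  have hFS : ∀ t, ‖F t‖ ≤ S := fun t => le_ciSup hbdd t
  have hS0 : 0 ≤ S := (norm_nonneg _).trans (hFS 0)
  have hFB : BddMeas F S := ⟨hF, Eventually.of_forall hFS⟩
  have hc : 0 < ‖𝓕 g ξ₀‖ := norm_pos_iff.2 hne
  have hnorm : ∀ s : ℝ, ‖Complex.exp (-(2 * π * Complex.I * ξ₀ * s))‖ = 1 := by
    intro s; rw [Complex.norm_exp]; simp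
  have hgi : Integrable (fun s : ℝ => g s * Complex.exp (-(2 * π * Complex.I * ξ₀ * s))) :=
    hg.mul_bdd (c := 1) (by fun_prop) (Eventually.of_forall fun s => (hnorm s).le)
  have hmod : Integrable (fun s => ‖g s‖ * meanModulus χ (-(ε * s))) := by
    refine hg.norm.mul_bdd (c := 2 * ∫ t, ‖χ t‖) ?_ (Eventually.of_forall fun s => ?_)
    · exact ((continuous_meanModulus hχ).comp (by fun_prop)).aestronglyMeasurable
    · rw [Real.norm_eq_abs, abs_of_nonneg (meanModulus_nonneg _ _)]
      exact meanModulus_le hχ _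
  have key : ∀ t, ‖F t‖ ≤ S / 2 := by
    intro t
    -- The term that is subtracted here is (g * F)(t) = 0.
    have e1 : 𝓕 g ξ₀ • F t =
        ∫ s : ℝ, (g s * Complex.exp (-(2 * π * Complex.I * ξ₀ * s))) •
          (F t - Complex.exp (2 * π * Complex.I * ξ₀ * s) • F (t - s)) := by
      have h1 : ∀ s : ℝ, (g s * Complex.exp (-(2 * π * Complex.I * ξ₀ * s))) •
          (F t - Complex.exp (2 * π * Complex.I * ξ₀ * s) • F (t - s)) =
          (g s * Complex.exp (-(2 * π * Complex.I * ξ₀ * s))) • F t - g s • F (t - s) := by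
        intro s
        rw [smul_sub, smul_smul, mul_assoc (g s), ← Complex.exp_add, neg_add_cancel, Complex.exp_zero,
          mul_one]
      have h3 : Integrable (fun s => g s • F (t - s)) :=
        hFB.convolutionExistsAt hg (ContinuousLinearMap.lsmul ℂ ℂ) t
      simp only [h1]
      rw [integral_sub (hgi.smul_const _) h3]
      have h2 : ∫ s, g s • F (t - s) = 0 := hgF t
      rw [h2, sub_zero, integral_smul_const]
      congr 1
      rw [Real.fourier_real_eq_integral_exp_smul]
      refine integral_congr_ae (Eventually.of_forall fun s => ?_)
      simp only [smul_eq_mul]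
      rw [mul_comm]
      congr 2
      push_cast
      ring
    have e2 : ‖𝓕 g ξ₀‖ * ‖F t‖ ≤ S * (‖𝓕 g ξ₀‖ / 2) := by
      rw [← norm_smul, e1]
      refine le_trans ?_ (mul_le_mul_of_nonneg_left hsmall hS0)
      rw [← integral_const_mul]
      refine norm_integral_le_of_norm_le (hmod.const_mul S) (Eventually.of_forall fun s => ?_)
      rw [norm_smul, norm_mul, hnorm, mul_one, norm_sub_rev]
      calc _ ≤ ‖g s‖ * (S * meanModulus χ (-(ε * s))) := by
            gcongr
            exact norm_modulate_translate_sub_le hε hFB hχ hrep s t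
        _ = _ := by ring
    have : ‖𝓕 g ξ₀‖ * ‖F t‖ ≤ ‖𝓕 g ξ₀‖ * (S / 2) := by linarith
    exact le_of_mul_le_mul_left this hc
  -- The supremum is finite, so being at most its own half forces it to be nonpositive.
  have : S ≤ S / 2 := ciSup_le key
  have : S ≤ 0 := by linarith
  exact norm_le_zero_iff.1 ((hFS t).trans this)

/-- Local form of the approximation theorem: near a frequency outside the Beurling spectrum, the
convolution with smooth band-limited functions vanishes. -/
theorem exists_pos_forall_convolution_eq_zero [CompleteSpace X] {φ : ℝ → X} {C : ℝ}
    (hφ : BddMeas φ C) {g : ℝ → ℂ} (hg : Integrable g)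
    (hgφ : ∀ t, (g ⋆[ContinuousLinearMap.lsmul ℂ ℂ] φ) t = 0) {ξ₀ : ℝ} (hne : 𝓕 g ξ₀ ≠ 0) :
    ∃ ε > 0, ∀ ψ : ℝ → ℂ, ContDiff ℝ 2 ψ → HasCompactSupport ψ →
      (∀ ξ, ψ ξ ≠ 0 → |ξ - ξ₀| ≤ ε) →
      ∀ t, (𝓕⁻ ψ ⋆[ContinuousLinearMap.lsmul ℂ ℂ] φ) t = 0 := by
  obtain ⟨V, hV, hVs, hV1⟩ := exists_contDiff_cutoff
  have hχ : Integrable (𝓕⁻ V) := integrable_fourierInv_of_hasCompactSupport hV hVs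
  have hFχ : 𝓕 (𝓕⁻ V) = V := fourier_fourierInv_of_integrable hV.continuous
    (hV.continuous.integrable_of_hasCompactSupport hVs) hχ
  set χ := 𝓕⁻ V with hχdef
  -- The width ε is chosen from g and ξ₀ alone: by dominated convergence the approximation error
  -- tends to 0 with ε. The same ε then serves every ψ.
  have hlim : Tendsto (fun ε : ℝ => ∫ s, ‖g s‖ * meanModulus χ (-(ε * s))) (𝓝 0)
      (𝓝 (∫ s, ‖g s‖ * meanModulus χ (-((0 : ℝ) * s)))) := by
    refine tendsto_integral_filter_of_dominated_convergence
      (fun s => ‖g s‖ * (2 * ∫ t, ‖χ t‖)) ?_ ?_ (hg.norm.mul_const _) ?_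
    · exact Eventually.of_forall fun ε => hg.1.norm.mul
        ((continuous_meanModulus hχ).comp (by fun_prop)).aestronglyMeasurable
    · refine Eventually.of_forall fun ε => Eventually.of_forall fun s => ?_
      rw [norm_mul, norm_norm, Real.norm_eq_abs, abs_of_nonneg (meanModulus_nonneg _ _)]
      gcongr
      exact meanModulus_le hχ _
    · refine Eventually.of_forall fun s => Tendsto.const_mul _ ?_
      have : Continuous fun ε : ℝ => meanModulus χ (-(ε * s)) :=
        (continuous_meanModulus hχ).comp (by fun_prop)
      exact this.tendsto 0
  simp only [zero_mul, neg_zero, meanModulus_zero, mul_zero, integral_zero] at hlim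
  have hc : 0 < ‖𝓕 g ξ₀‖ / 2 := half_pos (norm_pos_iff.2 hne)
  have hev : ∀ᶠ ε : ℝ in 𝓝[>] 0, ∫ s, ‖g s‖ * meanModulus χ (-(ε * s)) ≤ ‖𝓕 g ξ₀‖ / 2 :=
    ((hlim.eventually (gt_mem_nhds hc)).filter_mono nhdsWithin_le_nhds).mono fun _ h => h.le
  obtain ⟨ε, hsmall, hε⟩ := (hev.and self_mem_nhdsWithin).exists
  have hε : 0 < ε := hε
  refine ⟨ε, hε, fun ψ hψ hψs hsupp => ?_⟩
  have hψi := hψ.continuous.integrable_of_hasCompactSupport hψs (μ := volume)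
  have hf : Integrable (𝓕⁻ ψ) := integrable_fourierInv_of_hasCompactSupport hψ hψs
  have hFf : 𝓕 (𝓕⁻ ψ) = ψ := fourier_fourierInv_of_integrable hψ.continuous hψi hf
  have hfc : Continuous (𝓕⁻ ψ) := continuous_fourierInv hψi
  have hfb := norm_fourierInv_le ψ
  set f := 𝓕⁻ ψ with hfdef
  set Y : ℝ → ℂ := fun t => (ε : ℂ) * (Complex.exp (2 * π * Complex.I * ξ₀ * t) * χ (ε * t))
    with hY
  have hYi : Integrable Y := integrable_modulate_dilate hχ hε ξ₀
  -- The transform of Y is 1 wherever ψ is nonzero, so Y reproduces f, and by associativity it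
  -- reproduces f * φ.
  have hYf : (Y ⋆[ContinuousLinearMap.mul ℂ ℂ] f) = f := by
    refine eq_of_fourier_eq ?_ (hYi.integrable_convolution _ hf) hfc hf ?_
    · exact BddAbove.continuous_convolution_right_of_integrable _
        ⟨_, by rintro _ ⟨t, rfl⟩; exact hfb t⟩ hYi hfc
    · ext ξ
      rw [Real.fourier_mul_convolution_eq hYi hf, fourier_modulate_dilate χ hε, hFχ, hFf]
      by_cases h0 : ψ ξ = 0
      · rw [h0, mul_zero]
      · rw [hV1, one_mul]
        rw [abs_div, abs_of_pos hε, div_le_one hε]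
        exact hsupp ξ h0
  have hmul : ∀ (x y : ℂ) (z : X), ContinuousLinearMap.lsmul ℂ ℂ
      (ContinuousLinearMap.mul ℂ ℂ x y) z =
      ContinuousLinearMap.lsmul ℂ ℂ x (ContinuousLinearMap.lsmul ℂ ℂ y z) := by
    intro x y z; exact mul_smul x y z
  have hFm : AEStronglyMeasurable (f ⋆[ContinuousLinearMap.lsmul ℂ ℂ] φ) volume := by
    have h2 : AEStronglyMeasurable (fun p : ℝ × ℝ => f p.2 • φ (p.1 - p.2))
        (volume.prod volume) :=
      hf.1.comp_snd.smul (hφ.meas.comp_quasiMeasurePreserving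
        (quasiMeasurePreserving_sub_of_right_invariant volume volume))
    exact h2.integral_prod_right'
  refine eq_zero_of_convolution_eq_zero hε hFm
    (hφ.norm_convolution_le hf (ContinuousLinearMap.lsmul ℂ ℂ)) hg hχ ?_ ?_ hsmall hne
  · intro t
    rw [← BddMeas.convolution_assoc hYi hf hφ (ContinuousLinearMap.mul ℂ ℂ) _ _ _ hmul, hYf]
  · intro t
    rw [← BddMeas.convolution_assoc hg hf hφ (ContinuousLinearMap.mul ℂ ℂ)
      (ContinuousLinearMap.lsmul ℂ ℂ) _ _ hmul]
    have : (g ⋆[ContinuousLinearMap.mul ℂ ℂ] f) = (f ⋆[ContinuousLinearMap.mul ℂ ℂ] g) := by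
      rw [← convolution_flip]
      congr 1
      ext
      simp
    rw [this, BddMeas.convolution_assoc hf hg hφ (ContinuousLinearMap.mul ℂ ℂ)
      (ContinuousLinearMap.lsmul ℂ ℂ) _ _ hmul]
    have h0 : (g ⋆[ContinuousLinearMap.lsmul ℂ ℂ] φ) = fun _ => 0 := funext hgφ
    rw [h0]
    simp [convolution_def]

/-- A compact set off the Beurling spectrum has a smooth cutoff annihilating `φ`. -/
theorem exists_cutoff_convolution_eq_zero [CompleteSpace X] {φ : ℝ → X} {C : ℝ}
    (hφ : BddMeas φ C) {K : Set ℝ} (hK : IsCompact K)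
    (hsp : ∀ ξ ∈ K, 2 * π * ξ ∉ beurlingSpectrum φ) :
    ∃ ψ : ℝ → ℂ, ContDiff ℝ 2 ψ ∧ HasCompactSupport ψ ∧ (∀ ξ ∈ K, ∀ᶠ η in 𝓝 ξ, ψ η = 1) ∧
      ∀ t, (𝓕⁻ ψ ⋆[ContinuousLinearMap.lsmul ℂ ℂ] φ) t = 0 := by
  -- The extra smooth multiplier ρ makes the property stable under the products that arise when two
  -- cutoffs are glued.
  suffices h : ∃ ψ : ℝ → ℂ, ContDiff ℝ 2 ψ ∧ HasCompactSupport ψ ∧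
      (∀ ξ ∈ K, ∀ᶠ η in 𝓝 ξ, ψ η = 1) ∧ ∀ ρ : ℝ → ℂ, ContDiff ℝ 2 ρ →
      ∀ t, (𝓕⁻ (fun ξ => ρ ξ * ψ ξ) ⋆[ContinuousLinearMap.lsmul ℂ ℂ] φ) t = 0 by
    obtain ⟨ψ, h1, h2, h3, h4⟩ := h
    refine ⟨ψ, h1, h2, h3, ?_⟩
    simpa using h4 (fun _ => 1) contDiff_const
  refine hK.induction_on ?_ ?_ ?_ ?_
  · refine ⟨fun _ => 0, contDiff_const, HasCompactSupport.zero, by simp, fun ρ _ t => ?_⟩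
    simp [convolution_def, Real.fourierInv_eq]
  · rintro s t hst ⟨ψ, h1, h2, h3, h4⟩
    exact ⟨ψ, h1, h2, fun ξ hξ => h3 ξ (hst hξ), h4⟩
  · rintro s t ⟨ψ, h1, h2, h3, h4⟩ ⟨ψ', h1', h2', h3', h4'⟩
    -- This is 1 - (1 - ψ)(1 - ψ'), hence 1 wherever either cutoff is 1; the second summand is
    -- covered by the hypothesis on ψ' with multiplier ρ(1 - ψ).
    refine ⟨fun ξ => ψ ξ + (1 - ψ ξ) * ψ' ξ, by fun_prop, h2.add h2'.mul_left, ?_, ?_⟩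
    · rintro ξ (hξ | hξ)
      · filter_upwards [h3 ξ hξ] with η hη
        rw [hη]; ring
      · filter_upwards [h3' ξ hξ] with η hη
        rw [hη]; ring
    · intro ρ hρ t
      have d1 : ContDiff ℝ 2 (fun ξ => ρ ξ * ψ ξ) := by fun_prop
      have d2 : ContDiff ℝ 2 (fun ξ => ρ ξ * (1 - ψ ξ) * ψ' ξ) := by fun_prop
      have c1 : HasCompactSupport (fun ξ => ρ ξ * ψ ξ) := h2.mul_left
      have c2 : HasCompactSupport (fun ξ => ρ ξ * (1 - ψ ξ) * ψ' ξ) := h2'.mul_left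
      have i1 := d1.continuous.integrable_of_hasCompactSupport c1 (μ := volume)
      have i2 := d2.continuous.integrable_of_hasCompactSupport c2 (μ := volume)
      have e : 𝓕⁻ (fun ξ => ρ ξ * (ψ ξ + (1 - ψ ξ) * ψ' ξ)) =
          𝓕⁻ (fun ξ => ρ ξ * ψ ξ) + 𝓕⁻ (fun ξ => ρ ξ * (1 - ψ ξ) * ψ' ξ) := by
        ext r
        simp only [Pi.add_apply, Real.fourierInv_eq]
        rw [← integral_add]
        · refine integral_congr_ae (Eventually.of_forall fun ξ => ?_)
          simp only [← smul_add]
          congr 1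
          ring
        · simpa using (Real.fourierIntegral_convergent_iff (-r)).2 i1
        · simpa using (Real.fourierIntegral_convergent_iff (-r)).2 i2
      rw [e, ConvolutionExistsAt.add_distrib
        (hφ.convolutionExistsAt (integrable_fourierInv_of_hasCompactSupport d1 c1) _ t)
        (hφ.convolutionExistsAt (integrable_fourierInv_of_hasCompactSupport d2 c2) _ t),
        h4 ρ hρ t, h4' (fun ξ => ρ ξ * (1 - ψ ξ)) (by fun_prop) t, add_zero]
  · intro ξ₀ hξ₀
    have hn := hsp ξ₀ hξ₀
    simp only [beurlingSpectrum, mem_ofPred_eq, not_forall] at hn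
    obtain ⟨g, hg, hgφ, hne⟩ := hn
    rw [fourierL1_eq] at hne
    obtain ⟨ε, hε, hall⟩ := exists_pos_forall_convolution_eq_zero hφ hg hgφ hne
    let b : ContDiffBump ξ₀ := ⟨ε / 2, ε, half_pos hε, half_lt_self hε⟩
    have hb : ContDiff ℝ 2 (fun x => (b x : ℂ)) := Complex.ofRealCLM.contDiff.comp b.contDiff
    have hbs : HasCompactSupport (fun x => (b x : ℂ)) :=
      b.hasCompactSupport.comp_left (g := fun x : ℝ => (x : ℂ)) (by simp)
    refine ⟨Metric.ball ξ₀ (ε / 2), mem_nhdsWithin_of_mem_nhds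
      (Metric.ball_mem_nhds _ (half_pos hε)), fun x => (b x : ℂ), hb, hbs, fun ξ hξ => ?_, ?_⟩
    · filter_upwards [Metric.isOpen_ball.mem_nhds hξ] with η hη
      have : b η = 1 := b.one_of_mem_closedBall (Metric.ball_subset_closedBall hη)
      simp [this]
    · intro ρ hρ t
      refine hall _ (hρ.mul hb) hbs.mul_left (fun ξ hξ => ?_) t
      have h0 : b ξ ≠ 0 := by
        intro h; apply hξ; simp [h]
      have : ξ ∈ Function.support b := h0
      rw [b.support_eq] at this
      exact (by simpa [Real.dist_eq] using this : |ξ - ξ₀| < ε).le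

end Beurling

/-! ### Resolvent identity, openness of the resolvent set, smoothness along vertical lines. -/

section Resolvent

variable {X : Type*} [NormedAddCommGroup X] [NormedSpace ℂ X] {A : X →ₗ.[ℂ] X}

/-- The resolvent identity. -/
theorem IsResolventAt.sub_eq {z w : ℂ} {R S : X →L[ℂ] X} (hR : IsResolventAt A z R)
    (hS : IsResolventAt A w S) : R - S = (w - z) • (R * S) := by
  ext y
  obtain ⟨h, hy⟩ := hS.1 y
  have h1 := hR.2 ⟨S y, h⟩
  have h2 : z • S y - A ⟨S y, h⟩ = y + (z - w) • S y := by
    have h3 := congrArg (fun v => v + (z • S y - w • S y)) hy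
    rw [sub_smul, ← h3]
    abel
  simp only at h1
  rw [h2, map_add, map_smul] at h1
  simp only [sub_apply, smul_apply,
    mul_apply_eq_comp]
  nth_rewrite 1 [← h1]
  rw [← neg_sub z w, neg_smul]
  abel

theorem IsResolventAt.unique {z : ℂ} {R S : X →L[ℂ] X} (hR : IsResolventAt A z R)
    (hS : IsResolventAt A z S) : R = S := by
  have := hR.sub_eq hS
  rwa [sub_self, zero_smul, sub_eq_zero] at this

theorem isResolventAt_resolvent {z : ℂ} (hz : z ∉ spectrum A) :
    IsResolventAt A z (resolvent A z) := by
  have h : ∃ R, IsResolventAt A z R := not_not.1 hz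
  rw [resolvent, dif_pos h]
  exact h.choose_spec

theorem IsResolventAt.notMem_spectrum {z : ℂ} {R : X →L[ℂ] X} (hR : IsResolventAt A z R) :
    z ∉ spectrum A := fun h => h ⟨R, hR⟩

theorem IsResolventAt.resolvent_eq {z : ℂ} {R : X →L[ℂ] X} (hR : IsResolventAt A z R) :
    resolvent A z = R :=
  (isResolventAt_resolvent hR.notMem_spectrum).unique hR

theorem resolvent_sub_resolvent {z w : ℂ} (hz : z ∉ spectrum A) (hw : w ∉ spectrum A) :
    resolvent A z - resolvent A w = (w - z) • (resolvent A z * resolvent A w) :=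
  (isResolventAt_resolvent hz).sub_eq (isResolventAt_resolvent hw)

theorem resolvent_commute {z w : ℂ} (hz : z ∉ spectrum A) (hw : w ∉ spectrum A) :
    resolvent A z * resolvent A w = resolvent A w * resolvent A z := by
  by_cases h : w = z
  · rw [h]
  have h1 := resolvent_sub_resolvent hz hw
  have h2 := resolvent_sub_resolvent hw hz
  rw [← neg_sub, h1, ← neg_sub w z, neg_smul, neg_inj] at h2
  exact smul_right_injective _ (sub_ne_zero.2 h) h2

/-- On the domain, w - A = (1 - (z - w)R)(z - A), so inverting the bounded factor inverts w - A. -/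
theorem IsResolventAt.of_isUnit {z w : ℂ} {R : X →L[ℂ] X} (hR : IsResolventAt A z R)
    (hu : IsUnit (1 - (z - w) • R)) :
    IsResolventAt A w (R * Ring.inverse (1 - (z - w) • R)) := by
  set Q := Ring.inverse (1 - (z - w) • R) with hQ
  have hQ1 : (1 - (z - w) • R) * Q = 1 := Ring.mul_inverse_cancel _ hu
  have hQ2 : Q * (1 - (z - w) • R) = 1 := Ring.inverse_mul_cancel _ hu
  have hcomm : R * Q = Q * R := by
    have hc : Commute R (1 - (z - w) • R) :=
      (Commute.one_right R).sub_right ((Commute.refl R).smul_right _)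
    calc R * Q = Q * (1 - (z - w) • R) * (R * Q) := by rw [hQ2, one_mul]
      _ = Q * ((1 - (z - w) • R) * R) * Q := by simp only [mul_assoc]
      _ = Q * (R * (1 - (z - w) • R)) * Q := by rw [hc.eq]
      _ = Q * R * ((1 - (z - w) • R) * Q) := by simp only [mul_assoc]
      _ = Q * R := by rw [hQ1, mul_one]
  constructor
  · intro y
    obtain ⟨h, hy⟩ := hR.1 (Q y)
    refine ⟨h, ?_⟩
    have h1 := congrArg (fun L : X →L[ℂ] X => L y) hQ1
    simp only [mul_apply_eq_comp, sub_apply,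
      one_apply_eq_self, smul_apply] at h1
    simp only [mul_apply_eq_comp]
    have h2 : w • R (Q y) - A ⟨R (Q y), h⟩ =
        (z • R (Q y) - A ⟨R (Q y), h⟩) - (z - w) • R (Q y) := by rw [sub_smul]; abel
    rw [h2, hy, h1]
  · intro x
    have h1 := congrArg (fun L : X →L[ℂ] X => L (x : X)) hQ2
    simp only [mul_apply_eq_comp, sub_apply,
      one_apply_eq_self, smul_apply] at h1
    have h2 : w • (x : X) - A x = (z • (x : X) - A x) - (z - w) • (x : X) := by
      rw [sub_smul]; abel
    rw [hcomm, mul_apply_eq_comp, h2, map_sub, hR.2 x, map_smul]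
    exact h1

variable [CompleteSpace X]

theorem eventually_resolvent_eq {z : ℂ} (hz : z ∉ spectrum A) :
    ∀ᶠ w in 𝓝 z, w ∉ spectrum A ∧ resolvent A w =
      resolvent A z * Ring.inverse (1 - (z - w) • resolvent A z) := by
  have hc : Continuous fun w : ℂ => (1 : X →L[ℂ] X) - (z - w) • resolvent A z := by fun_prop
  have h1 : IsUnit ((1 : X →L[ℂ] X) - (z - z) • resolvent A z) := by simp
  filter_upwards [hc.continuousAt.preimage_mem_nhds (Units.isOpen.mem_nhds h1)] with w hw
  have := (isResolventAt_resolvent hz).of_isUnit hw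
  exact ⟨this.notMem_spectrum, this.resolvent_eq⟩

theorem isClosed_spectrum : IsClosed (spectrum A) := by
  rw [← isOpen_compl_iff, isOpen_iff_mem_nhds]
  intro z hz
  exact (eventually_resolvent_eq hz).mono fun _ h => h.1

theorem contDiffAt_resolvent {z : ℂ} (hz : z ∉ spectrum A) {n : ℕ∞} :
    ContDiffAt ℂ n (resolvent A) z := by
  have h : ContDiffAt ℂ n (fun w : ℂ => resolvent A z *
      Ring.inverse ((1 : X →L[ℂ] X) - (z - w) • resolvent A z)) z := by
    refine contDiffAt_const.mul ?_
    have h1 : ContDiffAt ℂ n (Ring.inverse : (X →L[ℂ] X) → (X →L[ℂ] X))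
        ((1 : X →L[ℂ] X) - (z - z) • resolvent A z) := by
      have := contDiffAt_ringInverse ℂ (1 : (X →L[ℂ] X)ˣ) (n := n)
      simpa using this
    exact h1.comp z (f := fun w : ℂ => (1 : X →L[ℂ] X) - (z - w) • resolvent A z)
      (by fun_prop)
  exact h.congr_of_eventuallyEq ((eventually_resolvent_eq hz).mono fun _ h => h.2)

theorem hasDerivAt_resolvent {z : ℂ} (hz : z ∉ spectrum A) :
    HasDerivAt (resolvent A) (-(resolvent A z * resolvent A z)) z := by
  rw [hasDerivAt_iff_tendsto_slope]
  have hc : ContinuousAt (resolvent A) z := (contDiffAt_resolvent hz (n := 0)).continuousAt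
  have h1 : Tendsto (fun w => -(resolvent A w * resolvent A z)) (𝓝[≠] z)
      (𝓝 (-(resolvent A z * resolvent A z))) :=
    ((hc.tendsto.mul_const _).neg).mono_left nhdsWithin_le_nhds
  refine h1.congr' ?_
  filter_upwards [self_mem_nhdsWithin,
    nhdsWithin_le_nhds (eventually_resolvent_eq hz)] with w hw1 hw2
  rw [slope_def_module, resolvent_sub_resolvent hw2.1 hz, smul_smul, ← neg_sub w z, mul_neg,
    inv_mul_cancel₀ (sub_ne_zero.2 hw1), neg_smul, one_smul]

/-- The resolvent along the vertical line through `c`, with the normalization of `𝓕`. -/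
def resLine (A : X →ₗ.[ℂ] X) (c : ℂ) (ξ : ℝ) : X →L[ℂ] X :=
  resolvent A (c + 2 * π * Complex.I * ξ)

theorem hasDerivAt_resLine {c : ℂ} {ξ : ℝ} (hξ : c + 2 * π * Complex.I * ξ ∉ spectrum A) :
    HasDerivAt (resLine A c)
      (-(2 * π * Complex.I : ℂ) • (resLine A c ξ * resLine A c ξ)) ξ := by
  have h1 : HasDerivAt (fun x : ℝ => c + 2 * π * Complex.I * (x : ℂ)) (2 * π * Complex.I) ξ := by
    have h0 : HasDerivAt (fun x : ℂ => c + 2 * π * Complex.I * x) (2 * π * Complex.I) (ξ : ℂ) := by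
      simpa using ((hasDerivAt_id (ξ : ℂ)).const_mul (2 * π * Complex.I : ℂ)).const_add c
    exact h0.comp_ofReal
  have h2 := HasDerivAt.scomp ξ (h := fun x : ℝ => c + 2 * π * Complex.I * (x : ℂ))
      (g₁ := resolvent A) (g₁' := -(resLine A c ξ * resLine A c ξ)) (hasDerivAt_resolvent hξ) h1
  rw [smul_neg, ← neg_smul] at h2
  exact h2

theorem contDiffAt_resLine {c : ℂ} {ξ : ℝ} (hξ : c + 2 * π * Complex.I * ξ ∉ spectrum A)
    {n : ℕ∞} : ContDiffAt ℝ n (resLine A c) ξ := by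
  have h1 : ContDiffAt ℝ n (fun x : ℝ => c + 2 * π * Complex.I * (x : ℂ)) ξ := by
    have : ContDiff ℝ n (fun x : ℝ => (x : ℂ)) := Complex.ofRealCLM.contDiff
    exact (contDiff_const.add (contDiff_const.mul this)).contDiffAt
  exact ((contDiffAt_resolvent hξ).restrict_scalars ℝ).comp ξ h1

end Resolvent

/-! ### The kernel e^{-t} T(t), its Laplace transform, and its integrability in operator norm. -/

section Semigroup

variable {X : Type*} [NormedAddCommGroup X] [NormedSpace ℂ X] {T : ℝ → X →L[ℂ] X}

theorem exists_generator_eq_of_tendsto {x y : X}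
    (h : Tendsto (fun h : ℝ => h⁻¹ • (T h x - x)) (𝓝[>] 0) (𝓝 y)) :
    ∃ hx : x ∈ (generator T).domain, generator T ⟨x, hx⟩ = y := by
  have := (mem_graph_generator T x y).2 h
  rw [LinearPMap.mem_graph_iff] at this
  obtain ⟨z, hz1, hz2⟩ := this
  obtain ⟨z, hz⟩ := z
  simp only at hz1 hz2
  subst hz1
  exact ⟨hz, hz2⟩

theorem tendsto_generator (x : (generator T).domain) :
    Tendsto (fun h : ℝ => h⁻¹ • (T h (x : X) - x)) (𝓝[>] 0) (𝓝 (generator T x)) :=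
  (mem_graph_generator T x _).1 (LinearPMap.mem_graph _ x)

/-- Strong continuity becomes joint continuity through the uniform bound M. Freezing the time at 0
on the negative axis gives functions continuous on all of ℝ. -/
theorem IsC0Semigroup.continuous_uncurry (hT : IsC0Semigroup T) {M : ℝ}
    (hM : ∀ t, 0 ≤ t → ‖T t‖ ≤ M) : Continuous (fun p : ℝ × X => T (max p.1 0) p.2) := by
  rw [continuous_iff_continuousAt]
  rintro ⟨t, x⟩
  have hc : Continuous (fun s : ℝ => T (max s 0) x) := by
    rw [← continuousOn_univ]
    exact (hT.continuousOn x).comp (by fun_prop) (fun s _ => le_max_right s 0)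
  have h1 : Tendsto (fun p : ℝ × X => T (max p.1 0) x) (𝓝 (t, x)) (𝓝 (T (max t 0) x)) :=
    (hc.comp continuous_fst).tendsto (t, x)
  have h2 : Tendsto (fun p : ℝ × X => T (max p.1 0) (p.2 - x)) (𝓝 (t, x)) (𝓝 0) := by
    have h3 : Tendsto (fun p : ℝ × X => M * ‖p.2 - x‖) (𝓝 (t, x)) (𝓝 0) := by
      have : Continuous (fun p : ℝ × X => M * ‖p.2 - x‖) := by fun_prop
      simpa using this.tendsto (t, x)
    refine squeeze_zero_norm (fun p => ?_) h3
    exact (T (max p.1 0)).le_of_opNorm_le (hM _ (le_max_right _ _)) _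
  have := h1.add h2
  simp only [map_sub, add_sub_cancel, add_zero] at this
  exact this

theorem IsC0Semigroup.continuous_orbit (hT : IsC0Semigroup T) {M : ℝ}
    (hM : ∀ t, 0 ≤ t → ‖T t‖ ≤ M) (x : X) : Continuous (fun t : ℝ => T (max t 0) x) :=
  (hT.continuous_uncurry hM).comp (by fun_prop : Continuous fun t : ℝ => (t, x))

/-- The kernel `e^{-t} T(t)` on `t > 0`, extended by zero. -/
def expKernel (T : ℝ → X →L[ℂ] X) (t : ℝ) : X →L[ℂ] X :=
  if 0 < t then Real.exp (-t) • T t else 0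

theorem expKernel_of_pos {t : ℝ} (ht : 0 < t) : expKernel T t = Real.exp (-t) • T t := if_pos ht

theorem expKernel_of_nonpos {t : ℝ} (ht : t ≤ 0) : expKernel T t = 0 := if_neg ht.not_gt

theorem norm_expKernel_le {M : ℝ} (hM : ∀ t, 0 ≤ t → ‖T t‖ ≤ M) (t : ℝ) :
    ‖expKernel T t‖ ≤ (Ioi (0 : ℝ)).indicator (fun t => M * Real.exp (-t)) t := by
  by_cases ht : 0 < t
  · rw [indicator_of_mem (mem_Ioi.2 ht), expKernel_of_pos ht, norm_smul, Real.norm_eq_abs,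
      Real.abs_exp, mul_comm]
    gcongr
    exact hM t ht.le
  · rw [expKernel_of_nonpos (not_lt.1 ht), norm_zero]
    exact indicator_nonneg (fun s (hs : 0 < s) => mul_nonneg
      ((norm_nonneg _).trans (hM s hs.le)) (Real.exp_nonneg _)) t

theorem integrable_indicator_exp (M : ℝ) :
    Integrable ((Ioi (0 : ℝ)).indicator (fun t => M * Real.exp (-t))) := by
  rw [integrable_indicator_iff measurableSet_Ioi]
  have := (exp_neg_integrableOn_Ioi 0 one_pos).const_mul M
  simpa [IntegrableOn] using this

theorem IsC0Semigroup.aestronglyMeasurable_expKernel_apply (hT : IsC0Semigroup T) {M : ℝ}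
    (hM : ∀ t, 0 ≤ t → ‖T t‖ ≤ M) (x : X) :
    AEStronglyMeasurable (fun t => expKernel T t x) volume := by
  have h : (fun t => expKernel T t x) =
      (Ioi (0 : ℝ)).indicator (fun t => Real.exp (-t) • T (max t 0) x) := by
    ext t
    by_cases ht : 0 < t
    · rw [indicator_of_mem (mem_Ioi.2 ht), expKernel_of_pos ht, max_eq_left ht.le]; rfl
    · rw [indicator_of_notMem (by simpa using ht), expKernel_of_nonpos (not_lt.1 ht)]; rfl
  rw [h]
  have : Continuous (fun t => Real.exp (-t) • T (max t 0) x) :=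
    (by fun_prop : Continuous fun t : ℝ => Real.exp (-t)).smul (hT.continuous_orbit hM x)
  exact this.aestronglyMeasurable.indicator measurableSet_Ioi

theorem IsC0Semigroup.integrable_expKernel_apply (hT : IsC0Semigroup T) {M : ℝ}
    (hM : ∀ t, 0 ≤ t → ‖T t‖ ≤ M) (x : X) : Integrable (fun t => expKernel T t x) := by
  refine ((integrable_indicator_exp M).mul_const ‖x‖).mono'
    (hT.aestronglyMeasurable_expKernel_apply hM x) (Eventually.of_forall fun t => ?_)
  exact (expKernel T t).le_of_opNorm_le (norm_expKernel_le hM t) x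

theorem expKernel_mul (hT : IsC0Semigroup T) {s t : ℝ} (hs : 0 < s) (ht : 0 < t) :
    expKernel T (s + t) = expKernel T s * expKernel T t := by
  rw [expKernel_of_pos (add_pos hs ht), expKernel_of_pos hs, expKernel_of_pos ht,
    hT.map_add s t hs.le ht.le, smul_mul_smul_comm, ← Real.exp_add]
  congr 2
  ring

/-- The Laplace transform of the semigroup on the line `Re z = 1`. -/
def laplace (hT : IsC0Semigroup T) {M : ℝ} (hM : ∀ t, 0 ≤ t → ‖T t‖ ≤ M) (ξ : ℝ) : X →L[ℂ] X :=
  LinearMap.mkContinuous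
    { toFun := fun x => 𝓕 (fun t => expKernel T t x) ξ
      map_add' := fun x y => by
        simp only [Real.fourier_eq, map_add, smul_add]
        exact integral_add
          ((Real.fourierIntegral_convergent_iff ξ).2 (hT.integrable_expKernel_apply hM x))
          ((Real.fourierIntegral_convergent_iff ξ).2 (hT.integrable_expKernel_apply hM y))
      map_smul' := fun c x => by
        simp only [Real.fourier_eq, map_smul, RingHom.id_apply]
        rw [← integral_smul]
        refine integral_congr_ae (Eventually.of_forall fun t => ?_)
        simp only
        rw [smul_comm] } M (fun x => by
      have h1 : ‖𝓕 (fun t => expKernel T t x) ξ‖ ≤ ∫ t, ‖expKernel T t x‖ :=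
        VectorFourier.norm_fourierIntegral_le_integral_norm _ _ _ _ _
      refine h1.trans ?_
      calc ∫ t, ‖expKernel T t x‖ ≤
          ∫ t, (Ioi (0 : ℝ)).indicator (fun t => M * Real.exp (-t)) t * ‖x‖ :=
            integral_mono (hT.integrable_expKernel_apply hM x).norm
              ((integrable_indicator_exp M).mul_const ‖x‖)
              fun t => (expKernel T t).le_of_opNorm_le (norm_expKernel_le hM t) x
        _ = M * ‖x‖ := by
            rw [integral_mul_const, integral_indicator measurableSet_Ioi, integral_const_mul,
              integral_exp_neg_Ioi_zero, mul_one])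

theorem laplace_apply (hT : IsC0Semigroup T) {M : ℝ} (hM : ∀ t, 0 ≤ t → ‖T t‖ ≤ M) (ξ : ℝ)
    (x : X) : laplace hT hM ξ x = 𝓕 (fun t => expKernel T t x) ξ := rfl

theorem norm_laplace_le (hT : IsC0Semigroup T) {M : ℝ} (hM : ∀ t, 0 ≤ t → ‖T t‖ ≤ M) (ξ : ℝ) :
    ‖laplace hT hM ξ‖ ≤ M :=
  LinearMap.mkContinuous_norm_le _ ((norm_nonneg _).trans (hM 0 le_rfl)) _

theorem laplace_eq_integral_Ioi (hT : IsC0Semigroup T) {M : ℝ} (hM : ∀ t, 0 ≤ t → ‖T t‖ ≤ M)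
    (ξ : ℝ) (x : X) : laplace hT hM ξ x = ∫ t in Ioi (0 : ℝ),
      Complex.exp (-(1 + 2 * π * Complex.I * ξ) * t) • T (max t 0) x := by
  rw [laplace_apply, Real.fourier_real_eq_integral_exp_smul, ← integral_indicator measurableSet_Ioi]
  refine integral_congr_ae (Eventually.of_forall fun t => ?_)
  by_cases ht : 0 < t
  · simp only [indicator_of_mem (mem_Ioi.2 ht), expKernel_of_pos ht, max_eq_left ht.le]
    rw [smul_apply, ← Complex.coe_smul, smul_smul, Complex.ofReal_exp,
      ← Complex.exp_add]
    congr 2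
    push_cast
    ring
  · simp only [indicator_of_notMem (show t ∉ Ioi 0 from ht), expKernel_of_nonpos (not_lt.1 ht)]
    simp

theorem norm_cexp_neg_line (ξ t : ℝ) :
    ‖Complex.exp (-(1 + 2 * π * Complex.I * ξ) * t)‖ = Real.exp (-t) := by
  rw [Complex.norm_exp]; simp

theorem integrableOn_laplace_integrand (hT : IsC0Semigroup T) {M : ℝ}
    (hM : ∀ t, 0 ≤ t → ‖T t‖ ≤ M) (ξ : ℝ) (x : X) : IntegrableOn (fun t : ℝ =>
      Complex.exp (-(1 + 2 * π * Complex.I * ξ) * t) • T (max t 0) x) (Ioi 0) := by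
  have h := (exp_neg_integrableOn_Ioi 0 one_pos).const_mul (M * ‖x‖)
  simp only [neg_mul, one_mul] at h
  refine h.mono' ?_ (Eventually.of_forall fun t => ?_)
  · exact ((by fun_prop : Continuous fun t : ℝ =>
      Complex.exp (-(1 + 2 * π * Complex.I * ξ) * t)).smul
        (hT.continuous_orbit hM x)).aestronglyMeasurable
  · rw [norm_smul, norm_cexp_neg_line, mul_comm]
    gcongr
    exact (T (max t 0)).le_of_opNorm_le (hM _ (le_max_right _ _)) x

theorem continuous_smul_expKernel_apply (hT : IsC0Semigroup T) {M : ℝ}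
    (hM : ∀ t, 0 ≤ t → ‖T t‖ ≤ M) (x : X) : Continuous (fun t : ℝ => t • expKernel T t x) := by
  have h : (fun t : ℝ => t • expKernel T t x) =
      fun t => (max t 0 * Real.exp (-t)) • T (max t 0) x := by
    ext t
    rcases lt_or_ge 0 t with ht | ht
    · rw [expKernel_of_pos ht, max_eq_left ht.le, smul_apply, smul_smul]
    · rw [expKernel_of_nonpos ht, max_eq_right ht]; simp
  rw [h]
  exact (by fun_prop : Continuous fun t : ℝ => max t 0 * Real.exp (-t)).smul
    (hT.continuous_orbit hM x)

theorem integrable_smul_expKernel_apply (hT : IsC0Semigroup T) {M : ℝ}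
    (hM : ∀ t, 0 ≤ t → ‖T t‖ ≤ M) (x : X) : Integrable (fun t : ℝ => t • expKernel T t x) := by
  have h1 : Integrable ((Ioi (0 : ℝ)).indicator (fun t => t * Real.exp (-t))) := by
    rw [integrable_indicator_iff measurableSet_Ioi]
    have := Real.GammaIntegral_convergent (s := 2) (by norm_num)
    refine this.congr_fun (fun t ht => ?_) measurableSet_Ioi
    norm_num
    ring
  refine (h1.mul_const (M * ‖x‖)).mono'
    (continuous_smul_expKernel_apply hT hM x).aestronglyMeasurable
    (Eventually.of_forall fun t => ?_)
  rcases lt_or_ge 0 t with ht | ht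
  · rw [indicator_of_mem (mem_Ioi.2 ht), expKernel_of_pos ht, smul_apply, smul_smul, norm_smul,
      Real.norm_eq_abs, abs_of_nonneg (by positivity)]
    gcongr
    exact (T t).le_of_opNorm_le (hM _ ht.le) x
  · rw [indicator_of_notMem (by simpa using ht), expKernel_of_nonpos ht]; simp

variable [CompleteSpace X]

theorem laplace_commute (hT : IsC0Semigroup T) {M : ℝ} (hM : ∀ t, 0 ≤ t → ‖T t‖ ≤ M)
    (ξ : ℝ) {h : ℝ} (hh : 0 ≤ h) (x : X) :
    T h (laplace hT hM ξ x) = laplace hT hM ξ (T h x) := by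
  rw [laplace_eq_integral_Ioi, laplace_eq_integral_Ioi, ← ContinuousLinearMap.integral_comp_comm _
    (integrableOn_laplace_integrand hT hM ξ x)]
  refine integral_congr_ae (Eventually.of_forall fun t => ?_)
  have h1 := hT.map_add h _ hh (le_max_right t 0)
  rw [add_comm, hT.map_add _ h (le_max_right t 0) hh] at h1
  simp only [map_smul]
  congr 1
  exact (congrArg (fun L : X →L[ℂ] X => L x) h1).symm

/-- The semigroup law shifts the Laplace integral to (h, ∞). All dependence on h is then in an
exponential and an integral over (0, h), both differentiable at h = 0. -/
theorem apply_laplace (hT : IsC0Semigroup T) {M : ℝ} (hM : ∀ t, 0 ≤ t → ‖T t‖ ≤ M)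
    (ξ : ℝ) {h : ℝ} (hh : 0 ≤ h) (x : X) :
    T h (laplace hT hM ξ x) = Complex.exp ((1 + 2 * π * Complex.I * ξ) * h) •
      (laplace hT hM ξ x - ∫ t in (0 : ℝ)..h,
        Complex.exp (-(1 + 2 * π * Complex.I * ξ) * t) • T (max t 0) x) := by
  set f : ℝ → X := fun t => Complex.exp (-(1 + 2 * π * Complex.I * ξ) * t) • T (max t 0) x with hf
  have hi := integrableOn_laplace_integrand hT hM ξ x
  have e1 : laplace hT hM ξ x - ∫ t in (0 : ℝ)..h, f t = ∫ t in Ioi h, f t := by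
    rw [laplace_eq_integral_Ioi, sub_eq_iff_eq_add', intervalIntegral.integral_interval_add_Ioi hi
      (hi.mono_set (Ioi_subset_Ioi hh))]
  have e2 : ∫ t in Ioi h, f t = ∫ t in Ioi (0 : ℝ), f (t + h) := by
    have := (measurePreserving_add_right volume h).setIntegral_preimage_emb
      (measurableEmbedding_addRight h) f (Ioi h)
    rw [← this]
    congr 2
    ext t
    simp
  rw [e1, e2, laplace_eq_integral_Ioi, ← integral_smul,
    ← ContinuousLinearMap.integral_comp_comm _ hi]
  refine setIntegral_congr_fun measurableSet_Ioi fun t (ht : 0 < t) => ?_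
  simp only [hf, map_smul]
  rw [smul_smul, ← Complex.exp_add, max_eq_left ht.le, max_eq_left (by positivity), add_comm t h,
    hT.map_add h t hh ht.le]
  congr 2
  push_cast
  ring

theorem tendsto_laplace (hT : IsC0Semigroup T) {M : ℝ} (hM : ∀ t, 0 ≤ t → ‖T t‖ ≤ M)
    (ξ : ℝ) (x : X) :
    Tendsto (fun h : ℝ => h⁻¹ • (T h (laplace hT hM ξ x) - laplace hT hM ξ x)) (𝓝[>] 0)
      (𝓝 ((1 + 2 * π * Complex.I * ξ) • laplace hT hM ξ x - x)) := by
  set c : ℂ := 1 + 2 * π * Complex.I * ξ with hc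
  set f : ℝ → X := fun t => Complex.exp (-c * t) • T (max t 0) x with hf
  have hfc : Continuous f := (by fun_prop : Continuous fun t : ℝ =>
      Complex.exp (-c * t)).smul (hT.continuous_orbit hM x)
  have h1 : HasDerivAt (fun h : ℝ => ∫ t in (0 : ℝ)..h, f t) (f 0) 0 :=
    intervalIntegral.integral_hasDerivAt_right (hfc.intervalIntegrable _ _)
      (hfc.stronglyMeasurableAtFilter _ _) hfc.continuousAt
  have h2 : HasDerivAt (fun h : ℝ => Complex.exp (c * h)) c 0 := by
    have : HasDerivAt (fun z : ℂ => Complex.exp (c * z)) c ((0 : ℝ) : ℂ) := by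
      simpa using ((hasDerivAt_id (0 : ℂ)).const_mul c).cexp
    exact this.comp_ofReal
  have h3 : HasDerivAt (fun h : ℝ => Complex.exp (c * h) •
      (laplace hT hM ξ x - ∫ t in (0 : ℝ)..h, f t)) _ 0 :=
    h2.smul (h1.const_sub (laplace hT hM ξ x))
  have h4 := h3.tendsto_slope_zero_right
  have hf0 : f 0 = x := by simp [hf, hT.map_zero]
  simp only [zero_add, Complex.ofReal_zero, mul_zero, Complex.exp_zero, one_smul,
    intervalIntegral.integral_same, sub_zero, hf0] at h4
  rw [neg_add_eq_sub] at h4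
  refine h4.congr' ?_
  filter_upwards [self_mem_nhdsWithin] with h (hh : 0 < h)
  rw [apply_laplace hT hM ξ hh.le]

/-- The right inverse is the difference quotient limit of `tendsto_laplace`; the left inverse
follows because the Laplace transform commutes with T(h), so that limit can also be taken inside. -/
theorem isResolventAt_laplace (hT : IsC0Semigroup T) {M : ℝ} (hM : ∀ t, 0 ≤ t → ‖T t‖ ≤ M)
    (ξ : ℝ) : IsResolventAt (generator T) (1 + 2 * π * Complex.I * ξ) (laplace hT hM ξ) := by
  constructor
  · intro y
    obtain ⟨h, hy⟩ := exists_generator_eq_of_tendsto (tendsto_laplace hT hM ξ y)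
    exact ⟨h, by rw [hy]; abel⟩
  · intro x
    have h1 : Tendsto (fun h : ℝ => h⁻¹ • (T h (laplace hT hM ξ x) - laplace hT hM ξ x)) (𝓝[>] 0)
        (𝓝 (laplace hT hM ξ (generator T x))) := by
      refine (((laplace hT hM ξ).continuous.tendsto _).comp (tendsto_generator x)).congr' ?_
      filter_upwards [self_mem_nhdsWithin] with h (hh : 0 < h)
      rw [laplace_commute hT hM ξ hh.le, Function.comp_apply, ← map_sub]
      exact ContinuousLinearMap.map_smul_of_tower (laplace hT hM ξ) h⁻¹ (T h (x : X) - x)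
    rw [map_sub, map_smul, ← tendsto_nhds_unique (tendsto_laplace hT hM ξ x) h1]
    abel

theorem resLine_one_eq_laplace (hT : IsC0Semigroup T) {M : ℝ} (hM : ∀ t, 0 ≤ t → ‖T t‖ ≤ M)
    (ξ : ℝ) : resLine (generator T) 1 ξ = laplace hT hM ξ :=
  (isResolventAt_laplace hT hM ξ).resolvent_eq

theorem notMem_spectrum_one (hT : IsC0Semigroup T) {M : ℝ} (hM : ∀ t, 0 ≤ t → ‖T t‖ ≤ M)
    (ξ : ℝ) : (1 + 2 * π * Complex.I * ξ : ℂ) ∉ spectrum (generator T) :=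
  (isResolventAt_laplace hT hM ξ).notMem_spectrum

/-- The ξ-derivative of the transform of N(t)x is computed twice: under the integral it brings down
-2πit, and from R' = -R² it is -2πi R²x. -/
theorem fourier_smul_expKernel_apply (hT : IsC0Semigroup T) {M : ℝ}
    (hM : ∀ t, 0 ≤ t → ‖T t‖ ≤ M) (x : X) (ξ : ℝ) :
    𝓕 (fun t : ℝ => t • expKernel T t x) ξ =
      (resLine (generator T) 1 ξ * resLine (generator T) 1 ξ) x := by
  have h1 := Real.hasDerivAt_fourier (hT.integrable_expKernel_apply hM x)
    (integrable_smul_expKernel_apply hT hM x) ξ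
  have h2 : HasDerivAt (𝓕 (fun t => expKernel T t x))
      ((-(2 * π * Complex.I : ℂ) •
        (resLine (generator T) 1 ξ * resLine (generator T) 1 ξ)) x) ξ := by
    have h3 := ((ContinuousLinearMap.apply ℂ X x).restrictScalars ℝ).hasFDerivAt.comp_hasDerivAt ξ
      (hasDerivAt_resLine (notMem_spectrum_one hT hM ξ))
    have h4 : 𝓕 (fun t => expKernel T t x) = fun ξ => resLine (generator T) 1 ξ x := by
      ext ξ; rw [resLine_one_eq_laplace hT hM, laplace_apply]
    rw [h4]
    exact h3
  have h5 := h1.unique h2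
  have h6 : 𝓕 (fun t : ℝ => (-2 * π * Complex.I * t : ℂ) • expKernel T t x) ξ =
      (-(2 * π * Complex.I : ℂ)) • 𝓕 (fun t : ℝ => t • expKernel T t x) ξ := by
    simp only [Real.fourier_eq]
    rw [← integral_smul]
    refine integral_congr_ae (Eventually.of_forall fun t => ?_)
    simp only
    rw [smul_comm (-(2 * π * Complex.I : ℂ)), ← Complex.coe_smul, smul_smul]
    congr 2
    ring
  rw [h6, smul_apply] at h5
  have hne : (-(2 * π * Complex.I : ℂ)) ≠ 0 := by
    simp [Real.pi_ne_zero]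
  exact smul_right_injective _ hne h5

/-- If the square of the resolvent is integrable along `Re z = 1`, the semigroup is norm
continuous away from zero. -/
theorem smul_expKernel_eq_fourierInv (hT : IsC0Semigroup T) {M : ℝ}
    (hM : ∀ t, 0 ≤ t → ‖T t‖ ≤ M)
    (hR : Integrable (fun ξ => resLine (generator T) 1 ξ * resLine (generator T) 1 ξ)) (t : ℝ) :
    t • expKernel T t =
      𝓕⁻ (fun ξ => resLine (generator T) 1 ξ * resLine (generator T) 1 ξ) t := by
  ext x
  have h1 : 𝓕 (fun t : ℝ => t • expKernel T t x) =
      fun ξ => (resLine (generator T) 1 ξ * resLine (generator T) 1 ξ) x :=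
    funext (fourier_smul_expKernel_apply hT hM x)
  have h2 := Continuous.fourierInv_fourier_eq (continuous_smul_expKernel_apply hT hM x)
    (integrable_smul_expKernel_apply hT hM x) (by
      rw [h1]; exact ((ContinuousLinearMap.apply ℂ X x).integrable_comp hR))
  have h3 := congrFun h2 t
  rw [h1] at h3
  rw [smul_apply, ← h3, Real.fourierInv_eq, Real.fourierInv_eq]
  have hi : Integrable (fun v : ℝ => 𝐞 (inner ℝ v t) •
      (resLine (generator T) 1 v * resLine (generator T) 1 v)) := by
    simpa using (Real.fourierIntegral_convergent_iff (-t)).2 hR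
  exact (ContinuousLinearMap.integral_apply hi x).symm

theorem continuous_smul_expKernel (hT : IsC0Semigroup T) {M : ℝ}
    (hM : ∀ t, 0 ≤ t → ‖T t‖ ≤ M)
    (hR : Integrable (fun ξ => resLine (generator T) 1 ξ * resLine (generator T) 1 ξ)) :
    Continuous (fun t : ℝ => t • expKernel T t) := by
  rw [funext (smul_expKernel_eq_fourierInv hT hM hR)]
  exact continuous_fourierInv hR

/-- The norm bound is immediate; the issue is measurability in operator norm, which strong
continuity alone does not provide. It comes from dividing the norm-continuous function t N(t) by t.
-/
theorem integrable_expKernel (hT : IsC0Semigroup T) {M : ℝ} (hM : ∀ t, 0 ≤ t → ‖T t‖ ≤ M)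
    (hR : Integrable (fun ξ => resLine (generator T) 1 ξ * resLine (generator T) 1 ξ)) :
    Integrable (expKernel T) := by
  refine (integrable_indicator_exp M).mono' ?_ (Eventually.of_forall (norm_expKernel_le hM))
  have h : (fun t : ℝ => t⁻¹ • t • expKernel T t) = expKernel T := by
    ext1 t
    by_cases ht : t = 0
    · rw [expKernel_of_nonpos ht.le]; simp
    · rw [smul_smul, inv_mul_cancel₀ ht, one_smul]
  rw [← h]
  exact measurable_inv.aestronglyMeasurable.smul
    (continuous_smul_expKernel hT hM hR).aestronglyMeasurable

theorem fourier_expKernel (hT : IsC0Semigroup T) {M : ℝ} (hM : ∀ t, 0 ≤ t → ‖T t‖ ≤ M)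
    (hR : Integrable (fun ξ => resLine (generator T) 1 ξ * resLine (generator T) 1 ξ)) (ξ : ℝ) :
    𝓕 (expKernel T) ξ = resLine (generator T) 1 ξ := by
  ext x
  rw [resLine_one_eq_laplace hT hM, laplace_apply, Real.fourier_eq, Real.fourier_eq,
    ContinuousLinearMap.integral_apply
      ((Real.fourierIntegral_convergent_iff ξ).2 (integrable_expKernel hT hM hR))]
  rfl

/-- By the semigroup law the integrand is the constant N(t) on (0, t). Thus N * N is norm continuous
under the resolvent hypothesis, although N itself may jump at 0. -/
theorem convolution_expKernel_self (hT : IsC0Semigroup T) (t : ℝ) :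
    (expKernel T ⋆[ContinuousLinearMap.mul ℂ (X →L[ℂ] X)] expKernel T) t = t • expKernel T t := by
  rw [convolution_def]
  have h : ∀ s, ContinuousLinearMap.mul ℂ (X →L[ℂ] X) (expKernel T s) (expKernel T (t - s)) =
      (Ioo 0 t).indicator (fun _ => expKernel T t) s := by
    intro s
    rw [ContinuousLinearMap.mul_apply']
    by_cases hs : s ∈ Ioo 0 t
    · rw [indicator_of_mem hs, ← expKernel_mul hT hs.1 (sub_pos.2 hs.2), add_sub_cancel]
    · rw [indicator_of_notMem hs]
      by_cases h0 : 0 < s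
      · rw [expKernel_of_nonpos (t := t - s), mul_zero]
        simp only [mem_Ioo, not_and, not_lt] at hs
        linarith [hs h0]
      · rw [expKernel_of_nonpos (not_lt.1 h0), zero_mul]
  simp only [h]
  rw [integral_indicator measurableSet_Ioo, setIntegral_const]
  rcases lt_or_ge 0 t with ht | ht
  · simp [Measure.real, ht.le]
  · rw [expKernel_of_nonpos ht]; simp

end Semigroup

/-! ### Integrability from power decay, and uniform continuity of convolutions. -/

section Kernel

theorem integrable_of_norm_le_rpow {E : Type*} [NormedAddCommGroup E] {f : ℝ → E}
    (hf : Continuous f) {b D p : ℝ} (hp : 1 < p)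
    (h : ∀ x, b ≤ |x| → ‖f x‖ ≤ D * |x| ^ (-p)) : Integrable f := by
  have hg : Integrable (fun x : ℝ => (1 + ‖x‖) ^ (-p)) := integrable_one_add_norm (by simpa using hp)
  refine hf.locallyIntegrable.integrable_of_isBigO_cocompact ?_ (hg.integrableAtFilter _)
  refine Asymptotics.IsBigO.of_bound (|D| * 2 ^ p) ?_
  filter_upwards [(tendsto_norm_cocompact_atTop (E := ℝ)).eventually
    (eventually_ge_atTop (max b 1))] with x hx
  rw [Real.norm_eq_abs] at hx ⊢
  have h1 : 1 ≤ |x| := (le_max_right _ _).trans hx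
  have h0 : 0 < |x| := by linarith
  refine (h x ((le_max_left _ _).trans hx)).trans ?_
  rw [Real.norm_eq_abs, abs_of_nonneg (by positivity : 0 ≤ (1 + |x|) ^ (-p)), mul_assoc]
  have h2 : |x| ^ (-p) ≤ 2 ^ p * (1 + |x|) ^ (-p) := by
    have h3 : (2 * |x|) ^ (-p) ≤ (1 + |x|) ^ (-p) :=
      Real.rpow_le_rpow_of_nonpos (by positivity) (by linarith) (by linarith)
    rw [Real.mul_rpow (by norm_num) h0.le] at h3
    calc |x| ^ (-p) = 2 ^ p * (2 ^ (-p) * |x| ^ (-p)) := by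
          rw [← mul_assoc, ← Real.rpow_add (by norm_num)]; simp
      _ ≤ _ := by gcongr
  exact mul_le_mul (le_abs_self D) h2 (by positivity) (abs_nonneg D)

variable {E F G : Type*} [NormedAddCommGroup E] [NormedSpace ℂ E]
  [NormedAddCommGroup F] [NormedSpace ℂ F] [NormedAddCommGroup G] [NormedSpace ℂ G]

theorem integral_sub_add {f g h : ℝ → E} (hf : Integrable f) (hg : Integrable g)
    (hh : Integrable h) : ∫ t, (f t - g t + h t) = (∫ t, f t) - (∫ t, g t) + ∫ t, h t := by
  have hfg : Integrable (fun t => f t - g t) := hf.sub hg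
  rw [integral_add hfg hh, integral_sub hf hg]

theorem fourier_sub_add_of_integrable {f g h : ℝ → E} (hf : Integrable f) (hg : Integrable g)
    (hh : Integrable h) (w : ℝ) :
    𝓕 (fun t => f t - g t + h t) w = 𝓕 f w - 𝓕 g w + 𝓕 h w := by
  simp only [Real.fourier_eq, smul_sub, smul_add]
  exact integral_sub_add ((Real.fourierIntegral_convergent_iff w).2 hf)
    ((Real.fourierIntegral_convergent_iff w).2 hg) ((Real.fourierIntegral_convergent_iff w).2 hh)

/-- The convolution `L¹ * L^∞` is uniformly continuous. -/
theorem BddMeas.uniformContinuous_convolution {f : ℝ → E} {g : ℝ → F} {C : ℝ}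
    (hf : Integrable f) (hg : BddMeas g C) (B : E →L[ℂ] F →L[ℂ] G) :
    UniformContinuous (f ⋆[B] g) := by
  have key : ∀ h t, ‖(f ⋆[B] g) (t + h) - (f ⋆[B] g) t‖ ≤ ‖B‖ * C * meanModulus f h := by
    intro h t
    have e1 : (f ⋆[B] g) (t + h) = ((fun s => f (h + s)) ⋆[B] g) t := by
      rw [convolution_def, convolution_def]
      refine (integral_add_left_eq_self (fun s => B (f s) (g (t + h - s))) h).symm.trans ?_
      refine integral_congr_ae (Eventually.of_forall fun s => ?_)
      have : t + h - (h + s) = t - s := by ring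
      simp only [this]
    have hi := hf.comp_add_left h
    have e2 : (f ⋆[B] g) (t + h) - (f ⋆[B] g) t = ((fun s => f (h + s) - f s) ⋆[B] g) t := by
      rw [e1, convolution_def, convolution_def, convolution_def,
        ← integral_sub (hg.convolutionExistsAt hi B t) (hg.convolutionExistsAt hf B t)]
      refine integral_congr_ae (Eventually.of_forall fun s => ?_)
      simp
    rw [e2]
    exact hg.norm_convolution_le (hi.sub hf) B t
  rw [Metric.uniformContinuous_iff]
  intro ε hε
  have hlim : Tendsto (fun h => ‖B‖ * C * meanModulus f h) (𝓝 0) (𝓝 0) := by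
    have := ((continuous_meanModulus hf).const_mul (‖B‖ * C)).tendsto 0
    simpa [meanModulus_zero] using this
  obtain ⟨δ, hδ, hb⟩ := Metric.eventually_nhds_iff.1 (hlim.eventually (gt_mem_nhds hε))
  refine ⟨δ, hδ, fun s t hst => ?_⟩
  rw [dist_eq_norm]
  have := key (s - t) t
  rw [add_sub_cancel] at this
  refine this.trans_lt (hb ?_)
  simpa [Real.dist_eq] using hst

end Kernel

/-! ### Decay of the resolvent, the correction kernel, and the bounded solution on the line. -/

section DecayingResolvent

variable {X : Type*} [NormedAddCommGroup X] [NormedSpace ℂ X]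

/-- Polynomial decay of the resolvent at infinity along the imaginary axis. -/
structure ResolventDecay (A : X →ₗ.[ℂ] X) (b D θ : ℝ) : Prop where
  one_le : 1 ≤ b
  half_lt : 1 / 2 < θ
  notMem : ∀ ξ : ℝ, b ≤ |ξ| → (0 + 2 * π * Complex.I * ξ : ℂ) ∉ spectrum A
  norm_le : ∀ ξ : ℝ, b ≤ |ξ| → ‖resLine A 0 ξ‖ ≤ D * |ξ| ^ (-θ)

/-- Replacing t by 2πξ costs nothing since |ξ| ≤ |2πξ|. Starting at max a 1 keeps |ξ| ≥ 1, so that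
higher powers of the decay can be absorbed later. -/
theorem exists_resolventDecay {A : X →ₗ.[ℂ] X} {a θ C : ℝ} (hθ : 1 / 2 < θ)
    (h1 : ∀ t : ℝ, Complex.I * t ∈ spectrum A → |t| < a)
    (h2 : ∀ t : ℝ, a ≤ |t| → |t| ^ θ * ‖resolvent A (Complex.I * t)‖ ≤ C) :
    ResolventDecay A (max a 1) C θ := by
  have hl : ∀ ξ : ℝ, (0 + 2 * π * Complex.I * ξ : ℂ) = Complex.I * (2 * π * ξ : ℝ) := by
    intro ξ; push_cast; ring
  have hp : 1 ≤ 2 * π := by linarith [Real.pi_gt_three]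
  have habs : ∀ ξ : ℝ, |ξ| ≤ |2 * π * ξ| := by
    intro ξ
    rw [abs_mul, abs_of_pos (by linarith : 0 < 2 * π)]
    nlinarith [abs_nonneg ξ]
  have ha : ∀ ξ : ℝ, max a 1 ≤ |ξ| → a ≤ |2 * π * ξ| := fun ξ hξ =>
    (le_max_left a 1).trans (hξ.trans (habs ξ))
  refine ⟨le_max_right _ _, hθ, fun ξ hξ hm => ?_, fun ξ hξ => ?_⟩
  · rw [hl] at hm
    exact absurd (h1 _ hm) (not_lt.2 (ha ξ hξ))
  · have h0 : 0 < |ξ| := one_pos.trans_le ((le_max_right _ _).trans hξ)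
    rw [resLine, hl, Real.rpow_neg h0.le, ← div_eq_mul_inv,
      le_div_iff₀ (Real.rpow_pos_of_pos h0 θ), mul_comm]
    refine le_trans ?_ (h2 _ (ha ξ hξ))
    exact mul_le_mul_of_nonneg_right (Real.rpow_le_rpow h0.le (habs ξ) (by linarith))
      (norm_nonneg _)

variable [CompleteSpace X] {T : ℝ → X →L[ℂ] X} {M b D θ : ℝ}

theorem resLine_zero_sub (hT : IsC0Semigroup T) (hM : ∀ t, 0 ≤ t → ‖T t‖ ≤ M) {ξ : ℝ}
    (hξ : (0 + 2 * π * Complex.I * ξ : ℂ) ∉ spectrum (generator T)) :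
    resLine (generator T) 0 ξ - resLine (generator T) 1 ξ =
      resLine (generator T) 0 ξ * resLine (generator T) 1 ξ := by
  have := resolvent_sub_resolvent hξ (notMem_spectrum_one hT hM ξ)
  rw [resLine, resLine, this]
  simp

theorem resLine_zero_sub' (hT : IsC0Semigroup T) (hM : ∀ t, 0 ≤ t → ‖T t‖ ≤ M) {ξ : ℝ}
    (hξ : (0 + 2 * π * Complex.I * ξ : ℂ) ∉ spectrum (generator T)) :
    resLine (generator T) 0 ξ - resLine (generator T) 1 ξ =
      resLine (generator T) 1 ξ * resLine (generator T) 0 ξ := by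
  rw [resLine_zero_sub hT hM hξ]
  exact resolvent_commute hξ (notMem_spectrum_one hT hM ξ)

/-- Decay passes from Re z = 0 to Re z = 1 by the resolvent identity R₁ = R₀ - R₀R₁ together with
‖R₁‖ ≤ M. -/
theorem ResolventDecay.norm_resLine_le (hd : ResolventDecay (generator T) b D θ)
    (hT : IsC0Semigroup T) (hM : ∀ t, 0 ≤ t → ‖T t‖ ≤ M) {ξ : ℝ} (hξ : b ≤ |ξ|) :
    ‖resLine (generator T) 0 ξ‖ ≤ (1 + M) * D * |ξ| ^ (-θ) ∧
      ‖resLine (generator T) 1 ξ‖ ≤ (1 + M) * D * |ξ| ^ (-θ) := by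
  have hM0 : 0 ≤ M := (norm_nonneg _).trans (hM 0 le_rfl)
  have h1 := hd.norm_le ξ hξ
  have h2 : ‖resLine (generator T) 1 ξ‖ ≤ (1 + M) * ‖resLine (generator T) 0 ξ‖ := by
    have h3 : resLine (generator T) 1 ξ = resLine (generator T) 0 ξ -
        resLine (generator T) 0 ξ * resLine (generator T) 1 ξ := by
      rw [← resLine_zero_sub hT hM (hd.notMem ξ hξ), sub_sub_cancel]
    have h4 : ‖resLine (generator T) 1 ξ‖ ≤ M := by
      rw [resLine_one_eq_laplace hT hM]; exact norm_laplace_le hT hM ξ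
    calc ‖resLine (generator T) 1 ξ‖ = ‖resLine (generator T) 0 ξ -
        resLine (generator T) 0 ξ * resLine (generator T) 1 ξ‖ := by rw [← h3]
      _ ≤ ‖resLine (generator T) 0 ξ‖ +
          ‖resLine (generator T) 0 ξ * resLine (generator T) 1 ξ‖ := norm_sub_le _ _
      _ ≤ ‖resLine (generator T) 0 ξ‖ + ‖resLine (generator T) 0 ξ‖ * M :=
          add_le_add le_rfl ((norm_mul_le _ _).trans (by gcongr))
      _ = _ := by ring
  have h5 : (1 + M) * ‖resLine (generator T) 0 ξ‖ ≤ (1 + M) * D * |ξ| ^ (-θ) := by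
    rw [mul_assoc]; gcongr
  exact ⟨le_trans (by nlinarith [norm_nonneg (resLine (generator T) 0 ξ)]) h5, h2.trans h5⟩

theorem contDiff_resLine_one (hT : IsC0Semigroup T) (hM : ∀ t, 0 ≤ t → ‖T t‖ ≤ M) :
    ContDiff ℝ 2 (resLine (generator T) 1) :=
  contDiff_iff_contDiffAt.2 fun ξ => contDiffAt_resLine (notMem_spectrum_one hT hM ξ) (n := 2)

theorem abs_rpow_neg_sq {x θ : ℝ} (hx : 0 < |x|) (B : ℝ) :
    (B * |x| ^ (-θ)) * (B * |x| ^ (-θ)) = B ^ 2 * |x| ^ (-(2 * θ)) := by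
  rw [show -(2 * θ) = -θ + -θ by ring, Real.rpow_add hx]
  ring

theorem ResolventDecay.integrable_sq (hd : ResolventDecay (generator T) b D θ)
    (hT : IsC0Semigroup T) (hM : ∀ t, 0 ≤ t → ‖T t‖ ≤ M) :
    Integrable (fun ξ => resLine (generator T) 1 ξ * resLine (generator T) 1 ξ) := by
  have hc := (contDiff_resLine_one hT hM).continuous
  refine integrable_of_norm_le_rpow (hc.mul hc) (b := b) (D := ((1 + M) * D) ^ 2) (p := 2 * θ)
    (by linarith [hd.half_lt]) fun ξ hξ => ?_
  have h := (hd.norm_resLine_le hT hM hξ).2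
  rw [← abs_rpow_neg_sq (one_pos.trans_le (hd.one_le.trans hξ))]
  exact (norm_mul_le _ _).trans (mul_le_mul h h (norm_nonneg _) ((norm_nonneg _).trans h))

/-- The symbol of the correction `W` such that `e^{-t} T(t) + W(t)` has the Fourier transform
`(1 - ψ) R(2πiξ, A)`. -/
def symbol (T : ℝ → X →L[ℂ] X) (ψ : ℝ → ℂ) (ξ : ℝ) : X →L[ℂ] X :=
  (1 - ψ ξ) • (resLine (generator T) 0 ξ * resLine (generator T) 1 ξ) -
    ψ ξ • resLine (generator T) 1 ξ

/-- `ψ` equals one near the part of the spectrum on the imaginary axis. -/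
def IsSpectralCutoff (T : ℝ → X →L[ℂ] X) (ψ : ℝ → ℂ) : Prop :=
  ∀ ξ : ℝ, (0 + 2 * π * Complex.I * ξ : ℂ) ∈ spectrum (generator T) → ∀ᶠ η in 𝓝 ξ, ψ η = 1

/-- Off the spectrum the symbol is (1 - ψ)R₀ - R₁, and the identity follows from R₀ - R₁ = R₁R₀. On
the spectrum ψ = 1, so the symbol is -R₁ and the default value of R₀ plays no role. -/
theorem symbol_eq (hT : IsC0Semigroup T) (hM : ∀ t, 0 ≤ t → ‖T t‖ ≤ M) {ψ : ℝ → ℂ}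
    (hψ : IsSpectralCutoff T ψ) (ξ : ℝ) :
    symbol T ψ ξ = resLine (generator T) 1 ξ * symbol T ψ ξ - ψ ξ • resLine (generator T) 1 ξ +
      resLine (generator T) 1 ξ * resLine (generator T) 1 ξ := by
  by_cases h : (0 + 2 * π * Complex.I * ξ : ℂ) ∈ spectrum (generator T)
  · have h1 : ψ ξ = 1 := (hψ ξ h).self_of_nhds
    simp only [symbol, h1, sub_self, zero_smul, one_smul, zero_sub, mul_neg]
    abel
  · have h1 := resLine_zero_sub' hT hM h
    rw [symbol]
    set R := resLine (generator T) 0 ξ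
    set S := resLine (generator T) 1 ξ
    have h2 : S * (R * S) = R * S - S * S := by rw [← mul_assoc, ← h1, sub_mul]
    rw [mul_sub, mul_smul_comm, mul_smul_comm, h2]
    module

/-- Near a spectral point ψ is identically 1 and the symbol is -R₁, which is smooth; this is why the
cutoff must be 1 on a neighbourhood. Elsewhere R₀ is smooth. -/
theorem contDiff_symbol (hT : IsC0Semigroup T) (hM : ∀ t, 0 ≤ t → ‖T t‖ ≤ M) {ψ : ℝ → ℂ}
    (hψ : IsSpectralCutoff T ψ) (hψ2 : ContDiff ℝ 2 ψ) : ContDiff ℝ 2 (symbol T ψ) := by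
  have h1 := contDiff_resLine_one hT hM
  rw [contDiff_iff_contDiffAt]
  intro ξ
  by_cases h : (0 + 2 * π * Complex.I * ξ : ℂ) ∈ spectrum (generator T)
  · refine (h1.neg.contDiffAt (x := ξ)).congr_of_eventuallyEq ?_
    filter_upwards [hψ ξ h] with η hη
    simp [symbol, hη]
  · have h0 : ContDiffAt ℝ 2 (resLine (generator T) 0) ξ := contDiffAt_resLine h (n := 2)
    exact ((contDiffAt_const.sub hψ2.contDiffAt).smul (h0.mul h1.contDiffAt)).sub
      (hψ2.contDiffAt.smul h1.contDiffAt)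

/-- Beyond the support of ψ the symbol is R₀R₁. Since R' is a multiple of R², each derivative only
adds resolvent factors, which are bounded there, so the decay |ξ|^{-2θ} persists. -/
theorem symbol_decay (hd : ResolventDecay (generator T) b D θ) (hT : IsC0Semigroup T)
    (hM : ∀ t, 0 ≤ t → ‖T t‖ ≤ M) {ψ : ℝ → ℂ} (hs : HasCompactSupport ψ) :
    ∃ b' K : ℝ, ∀ ξ, b' ≤ |ξ| → ‖symbol T ψ ξ‖ ≤ K * |ξ| ^ (-(2 * θ)) ∧
      ‖deriv (symbol T ψ) ξ‖ ≤ K * |ξ| ^ (-(2 * θ)) ∧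
      ‖deriv (deriv (symbol T ψ)) ξ‖ ≤ K * |ξ| ^ (-(2 * θ)) := by
  obtain ⟨r, hr⟩ := hs.isBounded.subset_closedBall 0
  set A := generator T with hA
  set B := (1 + M) * D with hB
  set κ : ℂ := -(2 * π * Complex.I) with hκ
  set U : Set ℝ := {ξ | max b r < |ξ|} with hU
  have hUo : IsOpen U := isOpen_lt continuous_const continuous_abs
  have hψ0 : ∀ ξ ∈ U, ψ ξ = 0 := by
    intro ξ hξ
    by_contra h
    have h1 := hr (subset_tsupport ψ h)
    rw [mem_closedBall_zero_iff, Real.norm_eq_abs] at h1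
    exact absurd (((le_max_right b r).trans_lt hξ).trans_le h1) (lt_irrefl _)
  have hbU : ∀ ξ ∈ U, b ≤ |ξ| := fun ξ hξ => ((le_max_left b r).trans_lt hξ).le
  have e0 : ∀ ξ ∈ U, symbol T ψ ξ = resLine A 0 ξ * resLine A 1 ξ := by
    intro ξ hξ; simp [symbol, hψ0 ξ hξ, hA]
  have d0 : ∀ ξ ∈ U, HasDerivAt (resLine A 0) (κ • (resLine A 0 ξ * resLine A 0 ξ)) ξ :=
    fun ξ hξ => hasDerivAt_resLine (hd.notMem ξ (hbU ξ hξ))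
  have d1 : ∀ ξ, HasDerivAt (resLine A 1) (κ • (resLine A 1 ξ * resLine A 1 ξ)) ξ :=
    fun ξ => hasDerivAt_resLine (notMem_spectrum_one hT hM ξ)
  have e1 : ∀ ξ ∈ U, deriv (symbol T ψ) ξ = κ • (resLine A 0 ξ * resLine A 0 ξ) * resLine A 1 ξ +
      resLine A 0 ξ * (κ • (resLine A 1 ξ * resLine A 1 ξ)) := by
    intro ξ hξ
    have : symbol T ψ =ᶠ[𝓝 ξ] fun ξ => resLine A 0 ξ * resLine A 1 ξ := by
      filter_upwards [hUo.mem_nhds hξ] with η hη using e0 η hη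
    rw [this.deriv_eq]
    exact ((d0 ξ hξ).mul (d1 ξ)).deriv
  have e2 : ∀ ξ ∈ U, deriv (deriv (symbol T ψ)) ξ =
      (κ • (κ • (resLine A 0 ξ * resLine A 0 ξ) * resLine A 0 ξ +
        resLine A 0 ξ * κ • (resLine A 0 ξ * resLine A 0 ξ)) * resLine A 1 ξ +
        κ • (resLine A 0 ξ * resLine A 0 ξ) * κ • (resLine A 1 ξ * resLine A 1 ξ)) +
      (κ • (resLine A 0 ξ * resLine A 0 ξ) * κ • (resLine A 1 ξ * resLine A 1 ξ) +
        resLine A 0 ξ * κ • (κ • (resLine A 1 ξ * resLine A 1 ξ) * resLine A 1 ξ +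
        resLine A 1 ξ * κ • (resLine A 1 ξ * resLine A 1 ξ))) := by
    intro ξ hξ
    have : deriv (symbol T ψ) =ᶠ[𝓝 ξ] fun ξ =>
        κ • (resLine A 0 ξ * resLine A 0 ξ) * resLine A 1 ξ +
          resLine A 0 ξ * (κ • (resLine A 1 ξ * resLine A 1 ξ)) := by
      filter_upwards [hUo.mem_nhds hξ] with η hη using e1 η hη
    rw [this.deriv_eq]
    have g0 := d0 ξ hξ
    have g1 := d1 ξ
    exact (((((g0.mul g0).const_smul κ).mul g1)).add
      (g0.mul ((g1.mul g1).const_smul κ))).deriv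
  have hκn : ‖κ‖ = 2 * π := by simp [hκ, abs_of_pos Real.pi_pos]
  -- With ρ bounding both resolvents, the first derivative has two terms of size 2πρ³ and the second
  -- six of size (2π)²ρ⁴. Two factors ρ are kept for the decay and the others are bounded by |B|.
  refine ⟨max b r + 1, max 1 (max (4 * π * |B|) (24 * π ^ 2 * |B| ^ 2)) * B ^ 2, fun ξ hξ => ?_⟩
  have hξU : ξ ∈ U := by
    have : max b r < |ξ| := by linarith
    exact this
  have hx1 : 1 ≤ |ξ| := hd.one_le.trans (hbU ξ hξU)
  obtain ⟨n0, n1⟩ := hd.norm_resLine_le hT hM (hbU ξ hξU)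
  rw [mul_assoc, ← abs_rpow_neg_sq (by linarith)]
  set ρ := B * |ξ| ^ (-θ) with hρ
  have hρ0 : 0 ≤ ρ := (norm_nonneg _).trans n0
  have hρB : ρ ≤ |B| := by
    rw [hρ]
    have h1 : |ξ| ^ (-θ) ≤ 1 := Real.rpow_le_one_of_one_le_of_nonpos hx1 (by linarith [hd.half_lt])
    have h2 : 0 ≤ |ξ| ^ (-θ) := by positivity
    nlinarith [le_abs_self B, abs_nonneg B]
  have m2 : ∀ {P Q : X →L[ℂ] X} {p q : ℝ}, ‖P‖ ≤ p → ‖Q‖ ≤ q → ‖P * Q‖ ≤ p * q := by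
    intro P Q p q hP hQ
    exact (norm_mul_le P Q).trans (mul_le_mul hP hQ (norm_nonneg _) ((norm_nonneg _).trans hP))
  have mk : ∀ {P : X →L[ℂ] X} {p : ℝ}, ‖P‖ ≤ p → ‖κ • P‖ ≤ 2 * π * p := by
    intro P p hP
    rw [norm_smul, hκn]
    exact mul_le_mul_of_nonneg_left hP (by positivity)
  have hK1 : (1 : ℝ) ≤ max 1 (max (4 * π * |B|) (24 * π ^ 2 * |B| ^ 2)) := le_max_left _ _
  have hK2 : 4 * π * |B| ≤ max 1 (max (4 * π * |B|) (24 * π ^ 2 * |B| ^ 2)) :=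
    (le_max_left _ _).trans (le_max_right _ _)
  have hK3 : 24 * π ^ 2 * |B| ^ 2 ≤ max 1 (max (4 * π * |B|) (24 * π ^ 2 * |B| ^ 2)) :=
    (le_max_right _ _).trans (le_max_right _ _)
  have hρρ : 0 ≤ ρ * ρ := mul_nonneg hρ0 hρ0
  refine ⟨?_, ?_, ?_⟩
  · rw [e0 ξ hξU]
    refine (m2 n0 n1).trans ?_
    nlinarith
  · rw [e1 ξ hξU]
    refine (norm_add_le_of_le (m2 (mk (m2 n0 n0)) n1) (m2 n0 (mk (m2 n1 n1)))).trans ?_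
    calc 2 * π * (ρ * ρ) * ρ + ρ * (2 * π * (ρ * ρ)) = 4 * π * ρ * (ρ * ρ) := by ring
      _ ≤ 4 * π * |B| * (ρ * ρ) := by gcongr
      _ ≤ _ := by gcongr
  · rw [e2 ξ hξU]
    have c0 := mk (m2 n0 n0)
    have c1 := mk (m2 n1 n1)
    refine (norm_add_le_of_le
      (norm_add_le_of_le (m2 (mk (norm_add_le_of_le (m2 c0 n0) (m2 n0 c0))) n1) (m2 c0 c1))
      (norm_add_le_of_le (m2 c0 c1)
        (m2 n0 (mk (norm_add_le_of_le (m2 c1 n1) (m2 n1 c1)))))).trans ?_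
    calc _ = 24 * π ^ 2 * ρ ^ 2 * (ρ * ρ) := by ring
      _ ≤ 24 * π ^ 2 * |B| ^ 2 * (ρ * ρ) := by gcongr
      _ ≤ _ := by gcongr

theorem integrable_symbol (hd : ResolventDecay (generator T) b D θ) (hT : IsC0Semigroup T)
    (hM : ∀ t, 0 ≤ t → ‖T t‖ ≤ M) {ψ : ℝ → ℂ} (hψ : IsSpectralCutoff T ψ)
    (hψ2 : ContDiff ℝ 2 ψ) (hs : HasCompactSupport ψ) :
    Integrable (symbol T ψ) ∧ Integrable (𝓕⁻ (symbol T ψ)) := by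
  obtain ⟨b', K, h⟩ := symbol_decay hd hT hM hs
  have hc := contDiff_symbol hT hM hψ hψ2
  have hc1 : ContDiff ℝ 1 (deriv (symbol T ψ)) :=
    (contDiff_succ_iff_deriv.1 (by rw [one_add_one_eq_two]; exact hc)).2.2
  have hp : 1 < 2 * θ := by linarith [hd.half_lt]
  have i0 := integrable_of_norm_le_rpow hc.continuous hp fun ξ hξ => (h ξ hξ).1
  have i1 := integrable_of_norm_le_rpow hc1.continuous hp fun ξ hξ => (h ξ hξ).2.1
  have i2 := integrable_of_norm_le_rpow (hc1.continuous_deriv (by norm_num)) hp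
    fun ξ hξ => (h ξ hξ).2.2
  exact ⟨i0, integrable_fourierInv hc i0 i1 i2⟩

/-- The kernel identity expressing that the correction solves the evolution equation up to a
convolution with the inverse Fourier transform of the cutoff. -/
theorem fourierInv_symbol_eq (hd : ResolventDecay (generator T) b D θ) (hT : IsC0Semigroup T)
    (hM : ∀ t, 0 ≤ t → ‖T t‖ ≤ M) {ψ : ℝ → ℂ} (hψ : IsSpectralCutoff T ψ)
    (hψ2 : ContDiff ℝ 2 ψ) (hs : HasCompactSupport ψ) :
    𝓕⁻ (symbol T ψ) = fun t =>
      ((expKernel T ⋆[ContinuousLinearMap.mul ℂ (X →L[ℂ] X)] 𝓕⁻ (symbol T ψ)) t -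
        (expKernel T ⋆[(ContinuousLinearMap.lsmul ℂ ℂ : ℂ →L[ℂ] (X →L[ℂ] X) →L[ℂ] _).flip]
          𝓕⁻ ψ) t) +
        (expKernel T ⋆[ContinuousLinearMap.mul ℂ (X →L[ℂ] X)] expKernel T) t := by
  obtain ⟨hi, hW⟩ := integrable_symbol hd hT hM hψ hψ2 hs
  have hR := hd.integrable_sq hT hM
  have hN := integrable_expKernel hT hM hR
  have hψi := hψ2.continuous.integrable_of_hasCompactSupport hs (μ := volume)
  have hψI : Integrable (𝓕⁻ ψ) := integrable_fourierInv_of_hasCompactSupport hψ2 hs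
  have hFW : 𝓕 (𝓕⁻ (symbol T ψ)) = symbol T ψ :=
    fourier_fourierInv_of_integrable (contDiff_symbol hT hM hψ hψ2).continuous hi hW
  have hFψ : 𝓕 (𝓕⁻ ψ) = ψ := fourier_fourierInv_of_integrable hψ2.continuous hψi hψI
  have i1 := hN.integrable_convolution (ContinuousLinearMap.mul ℂ (X →L[ℂ] X)) hW
  have i2 := hN.integrable_convolution
    (ContinuousLinearMap.lsmul ℂ ℂ : ℂ →L[ℂ] (X →L[ℂ] X) →L[ℂ] _).flip hψI
  have i3 := hN.integrable_convolution (ContinuousLinearMap.mul ℂ (X →L[ℂ] X)) hN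
  have bW : BddAbove (range fun t => ‖𝓕⁻ (symbol T ψ) t‖) :=
    ⟨_, by rintro _ ⟨t, rfl⟩; exact norm_fourierInv_le _ t⟩
  have bψ : BddAbove (range fun t => ‖𝓕⁻ ψ t‖) :=
    ⟨_, by rintro _ ⟨t, rfl⟩; exact norm_fourierInv_le _ t⟩
  refine eq_of_fourier_eq (continuous_fourierInv hi) hW ?_ ((i1.sub i2).add i3) ?_
  · refine ((BddAbove.continuous_convolution_right_of_integrable _ bW hN
      (continuous_fourierInv hi)).sub (BddAbove.continuous_convolution_right_of_integrable _ bψ hN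
      (continuous_fourierInv hψi))).add ?_
    -- Injectivity of 𝓕 is used for continuous functions, and N * N is continuous by its explicit
    -- form t N(t).
    rw [funext (convolution_expKernel_self hT)]
    exact continuous_smul_expKernel hT hM hR
  · ext1 ξ
    rw [fourier_sub_add_of_integrable i1 i2 i3,
      Real.fourier_mul_convolution_eq hN hW, Real.fourier_mul_convolution_eq hN hN,
      Real.fourier_bilin_convolution_eq _ hN hψI, hFW, hFψ, fourier_expKernel hT hM hR]
    exact symbol_eq hT hM hψ ξ

/-- The bounded solution on the line, in integral form. -/
theorem exists_bounded_solution (hd : ResolventDecay (generator T) b D θ) (hT : IsC0Semigroup T)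
    (hM : ∀ t, 0 ≤ t → ‖T t‖ ≤ M) {φ : ℝ → X} {C : ℝ} (hφ : BddMeas φ C)
    (hsp : ∀ w ∈ beurlingSpectrum φ, Complex.I * w ∉ spectrum (generator T)) :
    ∃ v : ℝ → X, UniformContinuous v ∧ (∃ K, ∀ t, ‖v t‖ ≤ K) ∧
      ∀ t, v t = ∫ s, expKernel T s (φ (t - s) + v (t - s)) := by
  set K : Set ℝ := {ξ | (0 + 2 * π * Complex.I * ξ : ℂ) ∈ spectrum (generator T)} with hK
  -- Closed because the spectrum is closed, bounded because the decay hypothesis excludes |ξ| ≥ b.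
  have hKc : IsCompact K := by
    refine Metric.isCompact_of_isClosed_isBounded ?_ ?_
    · have hc : Continuous fun ξ : ℝ => (0 + 2 * π * Complex.I * ξ : ℂ) := by fun_prop
      exact isClosed_spectrum.preimage hc
    · refine (Metric.isBounded_closedBall (x := (0 : ℝ)) (r := b)).subset fun ξ hξ => ?_
      rw [mem_closedBall_zero_iff, Real.norm_eq_abs]
      by_contra h
      exact hd.notMem ξ (not_le.1 h).le hξ
  obtain ⟨ψ, hψ2, hs, hψ, hψφ⟩ := exists_cutoff_convolution_eq_zero hφ hKc (fun ξ hξ hm => by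
    refine hsp _ hm ?_
    have hl : Complex.I * ((2 * π * ξ : ℝ) : ℂ) = (0 + 2 * π * Complex.I * ξ : ℂ) := by
      push_cast; ring
    rw [hl]; exact hξ)
  have hcut : IsSpectralCutoff T ψ := hψ
  obtain ⟨hi, hW⟩ := integrable_symbol hd hT hM hcut hψ2 hs
  have hR := hd.integrable_sq hT hM
  have hN := integrable_expKernel hT hM hR
  have hψI : Integrable (𝓕⁻ ψ) := integrable_fourierInv_of_hasCompactSupport hψ2 hs
  have hker := fourierInv_symbol_eq hd hT hM hcut hψ2 hs
  set W := 𝓕⁻ (symbol T ψ) with hWdef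
  set N := expKernel T with hNdef
  set I : (X →L[ℂ] X) →L[ℂ] X →L[ℂ] X := ContinuousLinearMap.id ℂ (X →L[ℂ] X) with hI
  have hNW : Integrable (fun t => N t + W t) := Integrable.fun_add (f := N) (g := W) hN hW
  set v := (fun t => N t + W t) ⋆[I] φ with hv
  have hvu : UniformContinuous v := hφ.uniformContinuous_convolution hNW I
  have hvb : ∀ t, ‖v t‖ ≤ ‖I‖ * C * ∫ s, ‖N s + W s‖ := hφ.norm_convolution_le hNW I
  refine ⟨v, hvu, ⟨_, hvb⟩, fun t => ?_⟩
  have hvB : BddMeas v (‖I‖ * C * ∫ s, ‖N s + W s‖) := BddMeas.of_continuous hvu.continuous hvb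
  have e1 : ∀ t, v t = (N ⋆[I] φ) t + (W ⋆[I] φ) t := fun t =>
    ConvolutionExistsAt.add_distrib (hφ.convolutionExistsAt hN I t) (hφ.convolutionExistsAt hW I t)
  have i1 := hN.integrable_convolution (ContinuousLinearMap.mul ℂ (X →L[ℂ] X)) hW
  have i2 := hN.integrable_convolution
    (ContinuousLinearMap.lsmul ℂ ℂ : ℂ →L[ℂ] (X →L[ℂ] X) →L[ℂ] _).flip hψI
  have i3 := hN.integrable_convolution (ContinuousLinearMap.mul ℂ (X →L[ℂ] X)) hN
  have hmul : ∀ (x y : X →L[ℂ] X) (z : X),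
      I (ContinuousLinearMap.mul ℂ (X →L[ℂ] X) x y) z = I x (I y z) := fun _ _ _ => rfl
  have a1 := BddMeas.convolution_assoc hN hW hφ (ContinuousLinearMap.mul ℂ (X →L[ℂ] X)) I I I
    hmul t
  have a3 := BddMeas.convolution_assoc hN hN hφ (ContinuousLinearMap.mul ℂ (X →L[ℂ] X)) I I I
    hmul t
  have a2 := BddMeas.convolution_assoc hN hψI hφ
    (ContinuousLinearMap.lsmul ℂ ℂ : ℂ →L[ℂ] (X →L[ℂ] X) →L[ℂ] _).flip I I
    (ContinuousLinearMap.lsmul ℂ ℂ) (fun x y z => (map_smul x y z).symm) t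
  -- Here the spectral hypothesis on φ enters: N * 𝓕⁻ψ * φ vanishes.
  rw [funext hψφ] at a2
  have a2' : (N ⋆[I] fun _ => (0 : X)) t = 0 := by simp [convolution_def]
  rw [a2'] at a2
  have e2 : (W ⋆[I] φ) t = (N ⋆[I] (W ⋆[I] φ)) t + (N ⋆[I] (N ⋆[I] φ)) t := by
    rw [← a1, ← a3]
    nth_rewrite 1 [hker]
    have s1 := hφ.convolutionExistsAt i1 I t
    have s2 := hφ.convolutionExistsAt i2 I t
    have s3 := hφ.convolutionExistsAt i3 I t
    rw [convolution_def] at a2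
    simp only [convolution_def I]
    have : ∀ s, I (((N ⋆[ContinuousLinearMap.mul ℂ (X →L[ℂ] X)] W) s -
        (N ⋆[(ContinuousLinearMap.lsmul ℂ ℂ : ℂ →L[ℂ] (X →L[ℂ] X) →L[ℂ] _).flip] 𝓕⁻ ψ) s) +
        (N ⋆[ContinuousLinearMap.mul ℂ (X →L[ℂ] X)] N) s) (φ (t - s)) =
        (I ((N ⋆[ContinuousLinearMap.mul ℂ (X →L[ℂ] X)] W) s) (φ (t - s)) -
        I ((N ⋆[(ContinuousLinearMap.lsmul ℂ ℂ : ℂ →L[ℂ] (X →L[ℂ] X) →L[ℂ] _).flip] 𝓕⁻ ψ) s)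
          (φ (t - s))) +
        I ((N ⋆[ContinuousLinearMap.mul ℂ (X →L[ℂ] X)] N) s) (φ (t - s)) := by
      intro s; simp
    simp only [this]
    refine (integral_sub_add s1.integrable s2.integrable s3.integrable).trans ?_
    rw [a2, sub_zero]
  have e3 : (N ⋆[I] v) t = (N ⋆[I] (N ⋆[I] φ)) t + (N ⋆[I] (W ⋆[I] φ)) t := by
    have b1 : BddMeas (N ⋆[I] φ) _ := BddMeas.of_continuous
      (hφ.uniformContinuous_convolution hN I).continuous (hφ.norm_convolution_le hN I)
    have b2 : BddMeas (W ⋆[I] φ) _ := BddMeas.of_continuous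
      (hφ.uniformContinuous_convolution hW I).continuous (hφ.norm_convolution_le hW I)
    have : v = (N ⋆[I] φ) + (W ⋆[I] φ) := funext e1
    rw [this]
    exact ConvolutionExistsAt.distrib_add (b1.convolutionExistsAt hN I t)
      (b2.convolutionExistsAt hN I t)
  have e4 : (N ⋆[I] (φ + v)) t = (N ⋆[I] φ) t + (N ⋆[I] v) t :=
    ConvolutionExistsAt.distrib_add (hφ.convolutionExistsAt hN I t)
      (hvB.convolutionExistsAt hN I t)
  have e5 : (N ⋆[I] (φ + v)) t = ∫ s, N s (φ (t - s) + v (t - s)) := rfl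
  rw [← e5, e4, e1 t, e3, e2]
  abel

end DecayingResolvent

theorem bddMeas_of_memLp_top {E : Type*} [NormedAddCommGroup E] {φ : ℝ → E} (hφ : MemLp φ ⊤ volume) :
    BddMeas φ (eLpNorm φ ⊤ volume).toReal := by
  refine ⟨hφ.1, ?_⟩
  filter_upwards [enorm_ae_le_eLpNormEssSup φ volume] with t ht
  rw [← eLpNorm_exponent_top] at ht
  have := ENNReal.toReal_mono hφ.2.ne ht
  simpa using this

/-! ### Mild solutions: superposition, existence from the integral equation, uniqueness. -/

section Mild

variable {X : Type*} [NormedAddCommGroup X] [NormedSpace ℂ X]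
  {T : ℝ → X →L[ℂ] X} {M : ℝ}

theorem IsMildSolution.intervalIntegrable {A : X →ₗ.[ℂ] X} {φ u : ℝ → X}
    (hu : IsMildSolution A φ (Ici 0) u) {t : ℝ} (ht : 0 ≤ t) :
    IntervalIntegrable u volume 0 t :=
  (hu.1.mono (by rw [uIcc_of_le ht]; exact Icc_subset_Ici_self)).intervalIntegrable

theorem IsC0Semigroup.hasDerivWithinAt (hT : IsC0Semigroup T) (x : (generator T).domain) (s : ℝ) :
    HasDerivWithinAt (fun r => T (r - s) (x : X)) (generator T x) (Ici s) s := by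
  rw [← hasDerivWithinAt_Ioi_iff_Ici, hasDerivWithinAt_iff_tendsto_slope' self_notMem_Ioi]
  have h1 : Tendsto (fun r : ℝ => r - s) (𝓝[>] s) (𝓝[>] 0) := by
    refine tendsto_nhdsWithin_iff.2 ⟨?_, ?_⟩
    · have : Continuous fun r : ℝ => r - s := by fun_prop
      have h := this.tendsto s
      rw [sub_self] at h
      exact h.mono_left nhdsWithin_le_nhds
    · filter_upwards [self_mem_nhdsWithin] with r (hr : s < r)
      exact sub_pos.2 hr
  refine ((tendsto_generator x).comp h1).congr fun r => ?_
  simp [slope_def_module, hT.map_zero]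

/-- Writing integration over a moving window as a convolution lets associativity move it past N. -/
theorem convolution_indicator_Ico {t : ℝ} (ht : 0 ≤ t) (f : ℝ → X) (q : ℝ) :
    ((Ico (-t) 0).indicator (fun _ => (1 : ℂ)) ⋆[ContinuousLinearMap.lsmul ℂ ℂ] f) q =
      ∫ s in (0 : ℝ)..t, f (q + s) := by
  rw [intervalIntegral.integral_of_le ht, convolution_def, ← integral_indicator measurableSet_Ioc,
    ← integral_neg_eq_self]
  refine integral_congr_ae (Eventually.of_forall fun s => ?_)
  simp only [ContinuousLinearMap.lsmul_apply]
  by_cases hs : s ∈ Ioc 0 t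
  · rw [indicator_of_mem hs, indicator_of_mem (show -s ∈ Ico (-t) 0 from
      ⟨by linarith [hs.2], by linarith [hs.1]⟩), one_smul,
      sub_neg_eq_add]
  · rw [indicator_of_notMem hs, indicator_of_notMem, zero_smul]
    rintro ⟨h1, h2⟩
    exact hs ⟨by linarith, by linarith⟩

theorem IsMildSolution.add_homogeneous {A : X →ₗ.[ℂ] X} {φ u w : ℝ → X}
    (hu : IsMildSolution A φ (Ici 0) u) (hw : IsMildSolution A (fun _ => 0) (Ici 0) w) :
    IsMildSolution A φ (Ici 0) (fun t => u t + w t) := by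
  refine ⟨hu.1.add hw.1, fun t ht => ?_⟩
  obtain ⟨h1, e1⟩ := hu.2 t ht
  obtain ⟨h2, e2⟩ := hw.2 t ht
  have e : ∫ s in (0 : ℝ)..t, (u s + w s) = (∫ s in (0 : ℝ)..t, u s) + ∫ s in (0 : ℝ)..t, w s :=
    intervalIntegral.integral_add (hu.intervalIntegrable ht) (hw.intervalIntegrable ht)
  have hm : ∫ s in (0 : ℝ)..t, (u s + w s) ∈ A.domain := by
    rw [e]; exact A.domain.add_mem h1 h2
  refine ⟨hm, ?_⟩
  have e3 : A ⟨∫ s in (0 : ℝ)..t, (u s + w s), hm⟩ = A ⟨_, h1⟩ + A ⟨_, h2⟩ := by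
    rw [← LinearPMap.map_add]
    congr 1
    exact Subtype.ext e
  rw [e3]
  change u t + w t = u 0 + w 0 + _ + _
  rw [e1, e2]
  simp only [intervalIntegral.integral_zero]
  abel

theorem IsMildSolution.sub_homogeneous {A : X →ₗ.[ℂ] X} {φ u w : ℝ → X}
    (hu : IsMildSolution A φ (Ici 0) u) (hw : IsMildSolution A φ (Ici 0) w) :
    IsMildSolution A (fun _ => 0) (Ici 0) (fun t => u t - w t) := by
  refine ⟨hu.1.sub hw.1, fun t ht => ?_⟩
  obtain ⟨h1, e1⟩ := hu.2 t ht
  obtain ⟨h2, e2⟩ := hw.2 t ht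
  have e : ∫ s in (0 : ℝ)..t, (u s - w s) = (∫ s in (0 : ℝ)..t, u s) - ∫ s in (0 : ℝ)..t, w s :=
    intervalIntegral.integral_sub (hu.intervalIntegrable ht) (hw.intervalIntegrable ht)
  have hm : ∫ s in (0 : ℝ)..t, (u s - w s) ∈ A.domain := by
    rw [e]; exact A.domain.sub_mem h1 h2
  refine ⟨hm, ?_⟩
  have e3 : A ⟨∫ s in (0 : ℝ)..t, (u s - w s), hm⟩ = A ⟨_, h1⟩ - A ⟨_, h2⟩ := by
    rw [← LinearPMap.map_sub]
    congr 1
    exact Subtype.ext e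
  rw [e3]
  change u t - w t = u 0 - w 0 + _ + _
  rw [e1, e2]
  simp only [intervalIntegral.integral_zero]
  abel

/-- The semigroup law factors T(s) out of T(t)y - T(s)y, and boundedness reduces everything to
continuity at time 0. -/
theorem uniformContinuousOn_orbit (hT : IsC0Semigroup T) (hM : ∀ t, 0 ≤ t → ‖T t‖ ≤ M) (y : X) :
    UniformContinuousOn (fun t => T (max t 0) y) (Ici 0) := by
  have hM0 : 0 ≤ M := (norm_nonneg _).trans (hM 0 le_rfl)
  have hle : ∀ s t, 0 ≤ s → s ≤ t →
      ‖T (max t 0) y - T (max s 0) y‖ ≤ M * ‖T (max (t - s) 0) y - y‖ := by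
    intro s t hs hst
    have : T (max t 0) y - T (max s 0) y = T s (T (max (t - s) 0) y - y) := by
      rw [max_eq_left (hs.trans hst), max_eq_left hs, max_eq_left (sub_nonneg.2 hst), map_sub]
      have h1 := hT.map_add s (t - s) hs (sub_nonneg.2 hst)
      rw [add_sub_cancel] at h1
      rw [h1]; rfl
    rw [this]
    exact (T s).le_of_opNorm_le (hM s hs) _
  have hlim : Tendsto (fun h : ℝ => M * ‖T (max h 0) y - y‖) (𝓝 0) (𝓝 0) := by
    have hc : Continuous fun h : ℝ => M * ‖T (max h 0) y - y‖ := by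
      exact continuous_const.mul ((hT.continuous_orbit hM y).sub continuous_const).norm
    have := hc.tendsto 0
    simpa [hT.map_zero] using this
  rw [Metric.uniformContinuousOn_iff]
  intro ε hε
  obtain ⟨δ, hδ, hb⟩ := Metric.eventually_nhds_iff.1 (hlim.eventually (gt_mem_nhds hε))
  refine ⟨δ, hδ, fun s hs t ht hst => ?_⟩
  rcases le_total s t with h | h
  · rw [dist_comm, dist_eq_norm]
    refine (hle s t hs h).trans_lt (hb ?_)
    rw [dist_comm] at hst
    simpa [Real.dist_eq] using hst
  · rw [dist_eq_norm]
    refine (hle t s ht h).trans_lt (hb ?_)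
    simpa [Real.dist_eq] using hst

variable [CompleteSpace X]

theorem hasDerivAt_integral_window {f : ℝ → X} (hf : Continuous f) (t : ℝ) :
    HasDerivAt (fun h : ℝ => ∫ s in h..(t + h), f s) (f t - f 0) 0 := by
  have h1 : ∀ a : ℝ, HasDerivAt (fun h : ℝ => ∫ s in (0 : ℝ)..h, f s) (f a) a := fun a =>
    intervalIntegral.integral_hasDerivAt_right (hf.intervalIntegrable _ _)
      (hf.stronglyMeasurableAtFilter _ _) hf.continuousAt
  have h2 : HasDerivAt (fun h : ℝ => ∫ s in (0 : ℝ)..(t + h), f s) (f t) 0 := by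
    have : HasDerivAt (fun h : ℝ => ∫ s in (0 : ℝ)..h, f s) (f t) (t + 0) := by
      simpa using h1 t
    exact this.comp_const_add t 0
  refine (h2.sub (h1 0)).congr_of_eventuallyEq (Eventually.of_forall fun h => ?_)
  exact (intervalIntegral.integral_interval_sub_left (hf.intervalIntegrable _ _)
    (hf.intervalIntegrable _ _)).symm

/-- The variation of constants formula for `e^{-t} T(t)`. -/
theorem duhamel (hT : IsC0Semigroup T) (hN : Integrable (expKernel T)) {g : ℝ → X} {C : ℝ}
    (hg : BddMeas g C) {h : ℝ} (hh : 0 ≤ h) :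
    Real.exp (-h) • T h (∫ s, expKernel T s (g (-s))) =
      (∫ s, expKernel T s (g (h - s))) - ∫ s in (0 : ℝ)..h, expKernel T s (g (h - s)) := by
  set F : ℝ → X := fun s => expKernel T s (g (h - s)) with hF
  have hFi : Integrable F :=
    hg.convolutionExistsAt hN (ContinuousLinearMap.id ℂ (X →L[ℂ] X)) h
  have hFi0 : Integrable (fun s => expKernel T s (g (-s))) := by
    have := hg.convolutionExistsAt hN (ContinuousLinearMap.id ℂ (X →L[ℂ] X)) 0
    simpa [ConvolutionExistsAt] using this
  have e1 : Real.exp (-h) • T h (∫ s, expKernel T s (g (-s))) =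
      ∫ s, (Ioi h).indicator F (s + h) := by
    rw [← ContinuousLinearMap.integral_comp_comm _ hFi0, ← integral_smul]
    refine integral_congr_ae (Eventually.of_forall fun s => ?_)
    simp only
    by_cases hs : 0 < s
    · rw [indicator_of_mem (by simpa using hs), hF]
      simp only
      rw [expKernel_of_pos hs, expKernel_of_pos (by positivity), add_comm s h,
        hT.map_add h s hh hs.le, show h - (h + s) = -s by ring]
      simp only [smul_apply, mul_apply_eq_comp, ContinuousLinearMap.map_smul_of_tower, smul_smul]
      rw [← Real.exp_add]
      congr 2
      ring
    · rw [indicator_of_notMem (by simpa using hs), expKernel_of_nonpos (not_lt.1 hs)]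
      simp
  have e2 : ∫ s in Iic (0 : ℝ), F s = 0 := by
    rw [setIntegral_congr_fun measurableSet_Iic (g := fun _ => 0), integral_zero]
    intro s (hs : s ≤ 0)
    simp [hF, expKernel_of_nonpos hs]
  rw [e1, integral_add_right_eq_self (fun s => (Ioi h).indicator F s) h,
    integral_indicator measurableSet_Ioi, eq_sub_iff_add_eq, ← intervalIntegral.integral_Iic_sub_Iic
      hFi.integrableOn hFi.integrableOn, e2, sub_zero, add_comm,
    intervalIntegral.integral_Iic_add_Ioi hFi.integrableOn hFi.integrableOn]

/-- The integrand is jointly continuous in (h, s) for s > 0, with limit g(0) at the origin; the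
value of the kernel at s = 0 is a null set. -/
theorem tendsto_average_expKernel (hT : IsC0Semigroup T) (hM : ∀ t, 0 ≤ t → ‖T t‖ ≤ M)
    {g : ℝ → X} (hg : Continuous g) :
    Tendsto (fun h : ℝ => h⁻¹ • ∫ s in (0 : ℝ)..h, expKernel T s (g (h - s))) (𝓝[>] 0)
      (𝓝 (g 0)) := by
  have hc : Continuous (fun p : ℝ × ℝ => Real.exp (-p.2) • T (max p.2 0) (g (p.1 - p.2))) := by
    have h1 : Continuous (fun p : ℝ × ℝ => T (max p.2 0) (g (p.1 - p.2))) :=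
      (hT.continuous_uncurry hM).comp
        (by fun_prop : Continuous fun p : ℝ × ℝ => (p.2, g (p.1 - p.2)))
    exact (by fun_prop : Continuous fun p : ℝ × ℝ => Real.exp (-p.2)).smul h1
  rw [Metric.tendsto_nhds]
  intro ε hε
  have h1 := Metric.continuousAt_iff.1 (hc.continuousAt (x := (0, 0))) (ε / 2) (half_pos hε)
  obtain ⟨δ, hδ, hb⟩ := h1
  filter_upwards [Ioo_mem_nhdsGT hδ] with h hh
  have hcont : Continuous fun s : ℝ => Real.exp (-s) • T (max s 0) (g (h - s)) :=
    hc.comp (by fun_prop : Continuous fun s : ℝ => (h, s))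
  have e1 : ∫ s in (0 : ℝ)..h, expKernel T s (g (h - s)) =
      ∫ s in (0 : ℝ)..h, Real.exp (-s) • T (max s 0) (g (h - s)) := by
    refine intervalIntegral.integral_congr_ae (Eventually.of_forall fun s hs => ?_)
    rw [uIoc_of_le hh.1.le] at hs
    rw [expKernel_of_pos hs.1, max_eq_left hs.1.le]
    rfl
  have e2 : h⁻¹ • (∫ s in (0 : ℝ)..h, expKernel T s (g (h - s))) - g 0 =
      h⁻¹ • ∫ s in (0 : ℝ)..h, (Real.exp (-s) • T (max s 0) (g (h - s)) - g 0) := by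
    rw [intervalIntegral.integral_sub (hcont.intervalIntegrable _ _)
      (continuous_const.intervalIntegrable _ _), e1, intervalIntegral.integral_const, sub_zero,
      smul_sub, smul_smul, inv_mul_cancel₀ hh.1.ne', one_smul]
  have e3 : ‖∫ s in (0 : ℝ)..h, (Real.exp (-s) • T (max s 0) (g (h - s)) - g 0)‖ ≤
      ε / 2 * |h - 0| := by
    refine intervalIntegral.norm_integral_le_of_norm_le_const fun s hs => ?_
    rw [uIoc_of_le hh.1.le] at hs
    have := hb (x := (h, s)) (by
      rw [Prod.dist_eq, max_lt_iff]
      simp only [Real.dist_eq, sub_zero, abs_of_pos hh.1, abs_of_pos hs.1]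
      exact ⟨hh.2, hs.2.trans_lt hh.2⟩)
    rw [dist_eq_norm] at this
    simp only [neg_zero, Real.exp_zero, max_self, hT.map_zero, one_smul, sub_self,
      one_apply_eq_self] at this
    exact this.le
  rw [dist_eq_norm, e2, norm_smul, norm_inv, Real.norm_eq_abs, abs_of_pos hh.1]
  rw [sub_zero, abs_of_pos hh.1] at e3
  calc h⁻¹ * _ ≤ h⁻¹ * (ε / 2 * h) := by
        have := hh.1
        gcongr
    _ = ε / 2 := by have := hh.1.ne'; field_simp
    _ < ε := half_lt_self hε

/-- A bounded solution of the integral equation on the line is a mild solution. -/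
theorem isMildSolution_of_integral_eq (hT : IsC0Semigroup T) (hM : ∀ t, 0 ≤ t → ‖T t‖ ≤ M)
    (hN : Integrable (expKernel T)) {φ v : ℝ → X} {C K : ℝ} (hφ : BddMeas φ C)
    (hv : Continuous v) (hvb : ∀ t, ‖v t‖ ≤ K)
    (heq : ∀ t, v t = ∫ s, expKernel T s (φ (t - s) + v (t - s))) :
    IsMildSolution (generator T) φ (Ici 0) v := by
  refine ⟨hv.continuousOn, fun t (ht : 0 ≤ t) => ?_⟩
  set I : (X →L[ℂ] X) →L[ℂ] X →L[ℂ] X := ContinuousLinearMap.id ℂ (X →L[ℂ] X) with hI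
  set k : ℝ → ℂ := (Ico (-t) 0).indicator (fun _ => (1 : ℂ)) with hk
  have hki : Integrable k := by
    rw [hk, integrable_indicator_iff measurableSet_Ico]
    exact integrableOn_const (by simp)
  have hvB : BddMeas v K := BddMeas.of_continuous hv hvb
  set g : ℝ → X := fun t => φ t + v t with hg
  have hgB : BddMeas g (C + K) := hφ.add hvB
  have hvg : v = expKernel T ⋆[I] g := funext heq
  -- Γ(q) integrates φ + v over [q, q + t]. Unlike φ + v it is continuous, so averages against N
  -- have a limit at 0.
  set Γ : ℝ → X := k ⋆[ContinuousLinearMap.lsmul ℂ ℂ] g with hΓ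
  have hΓc : Continuous Γ := (hgB.uniformContinuous_convolution hki _).continuous
  have hΓB : BddMeas Γ _ := BddMeas.of_continuous hΓc (hgB.norm_convolution_le hki _)
  have hz : ∀ q, ∫ s in (0 : ℝ)..t, v (q + s) = ∫ s, expKernel T s (Γ (q - s)) := by
    intro q
    rw [← convolution_indicator_Ico ht v q]
    have a1 := BddMeas.convolution_assoc hki hN hgB
      (ContinuousLinearMap.lsmul ℂ ℂ : ℂ →L[ℂ] (X →L[ℂ] X) →L[ℂ] _) I
      (ContinuousLinearMap.lsmul ℂ ℂ) I (fun x y z => rfl) q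
    have a2 := BddMeas.convolution_assoc hN hki hgB
      (ContinuousLinearMap.lsmul ℂ ℂ : ℂ →L[ℂ] (X →L[ℂ] X) →L[ℂ] _).flip I I
      (ContinuousLinearMap.lsmul ℂ ℂ) (fun x y z => (map_smul x y z).symm) q
    rw [convolution_flip, a1, ← hvg] at a2
    exact a2
  set z : X := ∫ s in (0 : ℝ)..t, v s with hzdef
  have hz0 : z = ∫ s, expKernel T s (Γ (-s)) := by
    have := hz 0
    simpa using this
  have hΓ0 : Γ 0 = (∫ s in (0 : ℝ)..t, φ s) + z := by
    rw [hΓ, convolution_indicator_Ico ht g 0]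
    simp only [zero_add, hg]
    refine intervalIntegral.integral_add ?_ (hv.intervalIntegrable _ _)
    rw [intervalIntegrable_iff]
    have h1 : IntegrableOn (fun _ : ℝ => C) (uIoc 0 t) := integrableOn_const (by simp)
    exact h1.mono' hφ.meas.restrict (ae_restrict_of_ae hφ.bdd)
  have hlim : Tendsto (fun h : ℝ => h⁻¹ • (T h z - z)) (𝓝[>] 0)
      (𝓝 (v t - v 0 - ∫ s in (0 : ℝ)..t, φ s)) := by
    have l1 := (hasDerivAt_integral_window hv t).tendsto_slope_zero_right
    have l2 := tendsto_average_expKernel hT hM hΓc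
    have l3 := (Real.hasDerivAt_exp 0).tendsto_slope_zero_right
    have l4 : Tendsto (fun h : ℝ => Real.exp h) (𝓝[>] 0) (𝓝 1) := by
      have := Real.continuous_exp.tendsto 0
      rw [Real.exp_zero] at this
      exact this.mono_left nhdsWithin_le_nhds
    -- By `duhamel`, T(h)z is e^h times the shifted window integral of v minus the integral of N
    -- against Γ over (0, h). The difference quotient splits into e^h times two quotients plus ((e^h
    -- - 1)/h) z; the last term cancels the z contained in Γ(0).
    have l5 := (l4.smul (l1.sub l2)).add (l3.smul_const z)
    have ht' : (1 : ℝ) • ((v t - v 0) - Γ 0) + Real.exp 0 • z =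
        v t - v 0 - ∫ s in (0 : ℝ)..t, φ s := by
      rw [hΓ0, Real.exp_zero]; module
    rw [ht'] at l5
    refine l5.congr' ?_
    filter_upwards [self_mem_nhdsWithin] with h (hh : 0 < h)
    have hd := duhamel hT hN hΓB hh.le
    rw [← hz0, ← hz h] at hd
    have e1 : ∫ s in (0 : ℝ)..t, v (h + s) = ∫ s in h..(t + h), v s := by
      simp [add_comm]
    rw [e1] at hd
    have e2 : T h z = Real.exp h • ((∫ s in h..(t + h), v s) -
        ∫ s in (0 : ℝ)..h, expKernel T s (Γ (h - s))) := by
      rw [← hd, smul_smul, ← Real.exp_add, add_neg_cancel, Real.exp_zero, one_smul]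
    rw [e2]
    simp only [zero_add, add_zero, Real.exp_zero, smul_eq_mul, ← hzdef]
    module
  obtain ⟨hmem, hA⟩ := exists_generator_eq_of_tendsto hlim
  exact ⟨hmem, by rw [hA]; abel⟩

theorem isMildSolution_orbit (hT : IsC0Semigroup T) (hM : ∀ t, 0 ≤ t → ‖T t‖ ≤ M) (y : X) :
    IsMildSolution (generator T) (fun _ => 0) (Ici 0) (fun t => T (max t 0) y) := by
  have hc := hT.continuous_orbit hM y
  refine ⟨hc.continuousOn, fun t (ht : 0 ≤ t) => ?_⟩
  have hlim : Tendsto (fun h : ℝ => h⁻¹ • (T h (∫ s in (0 : ℝ)..t, T (max s 0) y) -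
      ∫ s in (0 : ℝ)..t, T (max s 0) y)) (𝓝[>] 0) (𝓝 (T (max t 0) y - T (max 0 0) y)) := by
    refine (hasDerivAt_integral_window hc t).tendsto_slope_zero_right.congr' ?_
    filter_upwards [self_mem_nhdsWithin] with h (hh : 0 < h)
    have e1 : T h (∫ s in (0 : ℝ)..t, T (max s 0) y) = ∫ s in h..(t + h), T (max s 0) y := by
      rw [← ContinuousLinearMap.intervalIntegral_comp_comm _ (hc.intervalIntegrable _ _)]
      have : ∫ s in h..(t + h), T (max s 0) y = ∫ s in (0 : ℝ)..t, T (max (s + h) 0) y := by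
        rw [intervalIntegral.integral_comp_add_right (fun s => T (max s 0) y), zero_add]
      rw [this]
      refine intervalIntegral.integral_congr fun s hs => ?_
      rw [uIcc_of_le ht] at hs
      rw [max_eq_left hs.1, max_eq_left (by linarith [hs.1]), add_comm s h,
        hT.map_add h s hh.le hs.1]
      rfl
    rw [e1]
    simp
  obtain ⟨hmem, hA⟩ := exists_generator_eq_of_tendsto hlim
  exact ⟨hmem, by rw [hA]; simp⟩

/-- The primitive Z of w satisfies Z' = AZ with Z(0) = 0. For fixed t, s ↦ T(t - s)Z(s) has zero
right derivative, so its values Z(t) at s = t and 0 at s = 0 agree; then w = AZ = 0. -/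
theorem eq_zero_of_isMildSolution_homogeneous (hT : IsC0Semigroup T)
    (hM : ∀ t, 0 ≤ t → ‖T t‖ ≤ M) {w : ℝ → X}
    (hw : IsMildSolution (generator T) (fun _ => 0) (Ici 0) w) (hw0 : w 0 = 0) {t : ℝ}
    (ht : 0 ≤ t) : w t = 0 := by
  set w' : ℝ → X := fun s => w (max s 0) with hw'
  have hc : Continuous w' := by
    rw [← continuousOn_univ]
    exact hw.1.comp (by fun_prop) (fun s _ => le_max_right s 0)
  set Z : ℝ → X := fun s => ∫ r in (0 : ℝ)..s, w' r with hZ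
  have hZw : ∀ s, 0 ≤ s → ∫ r in (0 : ℝ)..s, w r = Z s := by
    intro s hs
    refine intervalIntegral.integral_congr fun r hr => ?_
    rw [uIcc_of_le hs] at hr
    simp [hw', max_eq_left hr.1]
  have hZd : ∀ s, HasDerivAt Z (w' s) s := fun s =>
    intervalIntegral.integral_hasDerivAt_right (hc.intervalIntegrable _ _)
      (hc.stronglyMeasurableAtFilter _ _) hc.continuousAt
  have hZA : ∀ s, 0 ≤ s → ∃ h : Z s ∈ (generator T).domain, w' s = generator T ⟨Z s, h⟩ := by
    intro s hs
    obtain ⟨h, e⟩ := hw.2 s hs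
    have h' : Z s ∈ (generator T).domain := hZw s hs ▸ h
    refine ⟨h', ?_⟩
    have : generator T ⟨Z s, h'⟩ = generator T ⟨_, h⟩ := by
      congr 1; exact Subtype.ext (hZw s hs).symm
    rw [this]
    simpa [hw0, hw', max_eq_left hs] using e
  have hZc : Continuous Z := continuous_iff_continuousAt.2 fun s => (hZd s).continuousAt
  have hM0 : 0 ≤ M := (norm_nonneg _).trans (hM 0 le_rfl)
  have hZt : ∀ t, 0 ≤ t → Z t = 0 := by
    intro t ht
    have hp : Continuous (fun s : ℝ => T (max (t - s) 0) (Z s)) :=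
      (hT.continuous_uncurry hM).comp (by fun_prop : Continuous fun s : ℝ => (t - s, Z s))
    have hd : ∀ s ∈ Ico 0 t,
        HasDerivWithinAt (fun s : ℝ => T (max (t - s) 0) (Z s)) 0 (Ici s) s := by
      intro s hs
      obtain ⟨hmem, hA⟩ := hZA s hs.1
      -- From the right at s, both Z(r) and T(r - s)Z(s) have derivative AZ(s), so their difference
      -- is o(r - s). The increment of T(t - s)Z(s) is T(t - r) applied to this difference, and ‖T‖
      -- ≤ M preserves the order; only right derivatives at points of the domain are needed.
      have hq := ((hZd s).hasDerivWithinAt (s := Ici s)).sub (hT.hasDerivWithinAt ⟨Z s, hmem⟩ s)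
      rw [hA, sub_self] at hq
      rw [hasDerivWithinAt_iff_isLittleO] at hq ⊢
      refine Asymptotics.IsBigO.trans_isLittleO ?_ hq
      refine Asymptotics.IsBigO.of_bound M ?_
      have hnear : ∀ᶠ r in 𝓝[≥] s, r < t := nhdsWithin_le_nhds (gt_mem_nhds hs.2)
      filter_upwards [self_mem_nhdsWithin, hnear] with r (hr : s ≤ r) hrt
      have e1 : T (t - s) (Z s) = T (t - r) (T (r - s) (Z s)) := by
        have := hT.map_add (t - r) (r - s) (by linarith) (by linarith)
        rw [show t - r + (r - s) = t - s by ring] at this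
        rw [this]; rfl
      have e2 : T (max (t - r) 0) (Z r) - T (max (t - s) 0) (Z s) - (r - s) • (0 : X) =
          T (t - r) (Z r - T (r - s) (Z s)) := by
        rw [max_eq_left (by linarith), max_eq_left (by linarith [hs.2]), e1, map_sub]
        simp
      have e3 : (Z - fun r => T (r - s) (Z s)) r - (Z - fun r => T (r - s) (Z s)) s -
          (r - s) • (0 : X) = Z r - T (r - s) (Z s) := by
        simp [hT.map_zero]
      rw [e2]
      refine ((T (t - r)).le_of_opNorm_le (hM _ (by linarith)) _).trans (le_of_eq ?_)
      rw [← e3]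
    have := constant_of_has_deriv_right_zero hp.continuousOn hd t (right_mem_Icc.2 ht)
    simpa [hT.map_zero, hZ] using this
  obtain ⟨h, e⟩ := hZA t ht
  have e1 : w t = w' t := by simp [hw', max_eq_left ht]
  rw [e1, e, show (⟨Z t, h⟩ : (generator T).domain) = 0 from Subtype.ext (hZt t ht),
    LinearPMap.map_zero]

end Mild

end EvolEq

end

end

/-! ### Assembly of existence, uniqueness and boundedness. -/

theorem corollary5p6 {X : Type*} [NormedAddCommGroup X] [NormedSpace ℂ X] [CompleteSpace X]
    (T : ℝ → X →L[ℂ] X) (hT : EvolEq.IsC0Semigroup T)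
    (hres : ∃ a θ C : ℝ, 0 < a ∧ 1 / 2 < θ ∧
      (∀ t : ℝ, Complex.I * t ∈ EvolEq.spectrum (EvolEq.generator T) → |t| < a) ∧
      ∀ t : ℝ, a ≤ |t| →
        |t| ^ θ * ‖EvolEq.resolvent (EvolEq.generator T) (Complex.I * t)‖ ≤ C)
    (φ : ℝ → X) (hφ : MemLp φ ⊤ volume)
    (hsp : ∀ w ∈ EvolEq.beurlingSpectrum φ,
      Complex.I * w ∉ EvolEq.spectrum (EvolEq.generator T))
    (hbdd : ∃ M : ℝ, ∀ t : ℝ, 0 < t → ‖T t‖ ≤ M) (x : X) :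
    (∃ u : ℝ → X, EvolEq.IsMildSolution (EvolEq.generator T) φ (Set.Ici 0) u ∧ u 0 = x) ∧
    (∀ u v : ℝ → X,
      EvolEq.IsMildSolution (EvolEq.generator T) φ (Set.Ici 0) u → u 0 = x →
      EvolEq.IsMildSolution (EvolEq.generator T) φ (Set.Ici 0) v → v 0 = x →
      Set.EqOn u v (Set.Ici 0)) ∧
    ∀ u : ℝ → X, EvolEq.IsMildSolution (EvolEq.generator T) φ (Set.Ici 0) u → u 0 = x →
      EvolEq.IsBUCOn u (Set.Ici 0) := by
  obtain ⟨a, θ, C, -, hθ, hspec, hdecay⟩ := hres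
  obtain ⟨M₀, hM₀⟩ := hbdd
  -- The given bound covers only t > 0, so the norm at t = 0 is included separately.
  have hM : ∀ t, 0 ≤ t → ‖T t‖ ≤ max M₀ ‖T 0‖ := by
    intro t ht
    rcases ht.eq_or_lt with rfl | ht
    · exact le_max_right _ _
    · exact (hM₀ t ht).trans (le_max_left _ _)
  have hd := EvolEq.exists_resolventDecay hθ hspec hdecay
  have hφB := EvolEq.bddMeas_of_memLp_top hφ
  have hN := EvolEq.integrable_expKernel hT hM (hd.integrable_sq hT hM)
  obtain ⟨v, hvu, ⟨K, hvb⟩, heq⟩ := EvolEq.exists_bounded_solution hd hT hM hφB hsp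
  have hv := EvolEq.isMildSolution_of_integral_eq hT hM hN hφB hvu.continuous hvb heq
  have hu := hv.add_homogeneous (EvolEq.isMildSolution_orbit hT hM (x - v 0))
  have hu0 : v 0 + T (max 0 0) (x - v 0) = x := by simp [hT.map_zero]
  have huniq : ∀ u w : ℝ → X,
      EvolEq.IsMildSolution (EvolEq.generator T) φ (Set.Ici 0) u → u 0 = x →
      EvolEq.IsMildSolution (EvolEq.generator T) φ (Set.Ici 0) w → w 0 = x →
      Set.EqOn u w (Set.Ici 0) := fun u w h1 h1' h2 h2' t ht =>
    sub_eq_zero.1 (EvolEq.eq_zero_of_isMildSolution_homogeneous hT hM (h1.sub_homogeneous h2)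
      (by rw [h1', h2', sub_self]) ht)
  refine ⟨⟨_, hu, hu0⟩, huniq, fun u h h0 => ?_⟩
  have he := huniq u _ h h0 hu hu0
  constructor
  · refine ⟨K + max M₀ ‖T 0‖ * ‖x - v 0‖, fun t ht => ?_⟩
    rw [he ht]
    exact norm_add_le_of_le (hvb t)
      ((T (max t 0)).le_of_opNorm_le (hM _ (le_max_right _ _)) _)
  · have h1 := EvolEq.uniformContinuousOn_orbit hT hM (x - v 0)
    rw [uniformContinuousOn_iff_restrict] at h1 ⊢
    rw [Set.domRestrict_eq_domRestrict_iff.2 he]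
    exact (hvu.comp uniformContinuous_subtype_val).add h1
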